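/- A (nonnegative-real-weighted Boolean) constraint of arity $k$ is a function $h:\{0,1\}^k\to\mathbb{R}^{\ge 0}$; its underlying relation is $R_h=\{x\mid h(x)\neq 0\}$. Write a binary constraint as $(h(00),h(01),h(10),h(11))$, so that $OR=(0,1,1,1)$, $NAND=(1,1,1,0)$ and $Implies=(1,1,0,1)$; put $\Delta_0=(1,0)$ and $\Delta_1=(0,1)$. The constraint $h$ has affine support if $R_h$ is the solution set of a system of linear equations over $GF(2)$, and it has imp support if $R_h$ is the conjunction of a positive number of relations of the forms $\Delta_0(x_i)$, $\Delta_1(x_i)$ and $Implies(x_i,x_j)$. Let $\mathcal{NZ}$ be the set of constraints that never take the value $0$, and $\mathcal{U}$ the set of all unary constraints. For a set $\mathcal{G}$ of constraints, an instance of $\mathrm{MAX\text{-}PROD\text{-}CSP}(\mathcal{G})$ is a number $n$ of Boolean variables $x_1,\dots,x_n$ together with a finite set $H$ of elements $\langle h,(x_{i_1},\dots,x_{i_k})\rangle$ with $h\in\mathcal{G}$ of arity $k$ and $i_1,\dots,i_k\in[n]$; its solutions are the truth assignments $\sigma$ to $x_1,\dots,x_n$, and the measure to be maximized is $m(H,\sigma)=\prod_{\langle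 h,(x_{i_1},\dots,x_{i_k})\rangle\in H}h(\sigma(x_{i_1}),\dots,\sigma(x_{i_k}))$. Write $\mathrm{MAX\text{-}PROD\text{-}CSP}^*(g,\mathcal{F})$ for $\mathrm{MAX\text{-}PROD\text{-}CSP}(\{g\}\cup\mathcal{F}\cup\mathcal{U})$. A solution $y$ of an instance $x$ with optimum value $m^*(x)$ is $\alpha$-approximate if $1/\alpha\le m(x,y)/m^*(x)\le\alpha$ in the case $m^*(x)\neq0$, and $m(x,y)=0$ in the case $m^*(x)=0$. A randomized approximation scheme takes an instance $x$ and $\varepsilon\in(0,1)$ and outputs a $2^{\varepsilon}$-approximate solution of $x$ with probability at least $3/4$. An APT-reduction from a maximization problem $P$ to a maximization problem $Q$ is a randomized oracle algorithm $N$ with inputs $(x,\varepsilon)$, $x$ an instance of $P$ and $\varepsilon\in(0,1)$, such that, for every randomized approximation scheme $M$ for $Q$ (not necessarily time-bounded) used as oracle, (i) $N$ is a randomized approximation scheme for $P$; (ii) every oracle call is a pair $(w,\delta)$ of an instance $w$ of $Q$ and $\delta\in(0,1)$ with $1/\delta\le p(|x|,1/\varepsilon)$, where $p$ is a polynomial,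 and the answer is an outcome of $M$ on $(w,\delta)$; and (iii) the running time of $N$ is at most $q(|x|,1/\varepsilon)$, where $q$ is a polynomial; here $p$ and $q$ do not depend on $M$, $x$ or $\varepsilon$. Algorithms are real-number (Blum–Shub–Smale) machines with coin flips and unit-cost exact arithmetic, and an instance is given as a string of reals consisting of $n$ in unary and, for each element of $H$, the arity, the table of values and the variable indices; its size $|x|$ is the length of that string. **Proposition.** Let $\mathcal{F}$ be any set of constraints and let $f\notin\mathcal{NZ}$ be any constraint. If $f$ has neither affine support nor imp support, then there exists a constraint $g\in\{OR,NAND\}$ such that $\mathrm{MAX\text{-}PROD\text{-}CSP}^*(g,\mathcal{F})$ is APT-reducible to $\mathrm{MAX\text{-}PROD\text{-}CSP}^*(f,\mathcal{F})$. -/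

import Mathlib

open scoped NNReal ENNReal

noncomputable section

namespace MaxProd

/-! ### Constraints and relations -/

/-- A nonnegative-real-weighted Boolean constraint of some arity `k`,
that is, a function `{0,1}^k → ℝ≥0` (`false` is `0`, `true` is `1`). -/
structure Constraint where
  arity : ℕ
  val : (Fin arity → Bool) → ℝ≥0

/-- `OR = (0,1,1,1)`. -/
def OR : Constraint := ⟨2, fun x => if x 0 = false ∧ x 1 = false then 0 else 1⟩

/-- `NAND = (1,1,1,0)`. -/
def NAND : Constraint := ⟨2, fun x => if x 0 = true ∧ x 1 = true then 0 else 1⟩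

/-- The set of all unary constraints. -/
def U : Set Constraint := {f | f.arity = 1}

/-- The set of all constraints that never take the value zero. -/
def NZ : Set Constraint := {f | ∀ x, f.val x ≠ 0}

/-- The underlying relation `R_f = {x | f x ≠ 0}`. -/
def Constraint.support (f : Constraint) : Set (Fin f.arity → Bool) := {x | f.val x ≠ 0}

/-- A Boolean value as an element of `GF(2)`. -/
def toF2 (b : Bool) : ZMod 2 := if b then 1 else 0

/-- A relation is affine if it is the solution set of a (finite) system of linear equations
over `GF(2)`. -/
def IsAffine {k : ℕ} (R : Set (Fin k → Bool)) : Prop :=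
  ∃ (m : ℕ) (A : Matrix (Fin m) (Fin k) (ZMod 2)) (b : Fin m → ZMod 2),
    R = {x | A.mulVec (fun i => toF2 (x i)) = b}

def Constraint.HasAffineSupport (f : Constraint) : Prop := IsAffine f.support

/-- The relations `Δ₀(x_i)`, `Δ₁(x_i)` and `Implies(x_i, x_j)` on `k` variables. -/
inductive ImpAtom (k : ℕ) where
  | delta0 (i : Fin k)
  | delta1 (i : Fin k)
  | implies (i j : Fin k)

def ImpAtom.Holds {k : ℕ} (x : Fin k → Bool) : ImpAtom k → Prop
  | .delta0 i => x i = false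
  | .delta1 i => x i = true
  | .implies i j => x i = true → x j = true

/-- The underlying relation is a conjunction of a positive number of relations
`Δ₀(x)`, `Δ₁(x)`, `Implies(x,y)`. -/
def Constraint.HasImpSupport (f : Constraint) : Prop :=
  ∃ L : List (ImpAtom f.arity), L ≠ [] ∧ f.support = {x | ∀ a ∈ L, a.Holds x}

/-! ### Maximization problems -/

/-- A maximization problem. Since the data of the problems considered here are real numbers,
an instance is presented to an algorithm as a finite string of reals, one real per cell, and its
size is the length of that string. Solutions are finite bit strings. -/
structure MaxProblem where
  Inst : Type
  enc : Inst → List ℝ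
  enc_injective : Function.Injective enc
  Sol : Inst → Set (List Bool)
  measure : Inst → List Bool → ℝ≥0

namespace MaxProblem

variable (P : MaxProblem)

def size (x : P.Inst) : ℕ := (P.enc x).length

def IsOptimal (x : P.Inst) (z : List Bool) : Prop :=
  z ∈ P.Sol x ∧ ∀ y ∈ P.Sol x, P.measure x y ≤ P.measure x z

/-- `y` is an `α`-approximate solution for the instance `x`: it is a solution and
`1/α ≤ m(x,y)/m*(x) ≤ α`, except that `m(x,y) = 0` is demanded if `m*(x) = 0`. -/
def IsApproxSol (x : P.Inst) (α : ℝ) (y : List Bool) : Prop :=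
  y ∈ P.Sol x ∧ ∃ z, P.IsOptimal x z ∧
    (P.measure x z = 0 → P.measure x y = 0) ∧
    (P.measure x z ≠ 0 →
      1 / α ≤ (P.measure x y : ℝ) / P.measure x z ∧
      (P.measure x y : ℝ) / P.measure x z ≤ α)

/-- The random bit string `D` is a `2^ε`-approximate solution for `x`
with probability at least `3/4`. -/
def ApproxLikely (x : P.Inst) (ε : ℝ) (D : PMF (List Bool)) : Prop :=
  (3 / 4 : ℝ≥0∞) ≤ D.toOuterMeasure {y | P.IsApproxSol x (2 ^ ε) y}

/-- `M`, a (not necessarily time-bounded) random map on input strings, is a randomized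
approximation scheme for `P`: on the input `(x, ε)`, presented as the string `ε :: enc x`, it
outputs a `2^ε`-approximate solution with probability at least `3/4`. -/
def IsApproxScheme (M : List ℝ → PMF (List Bool)) : Prop :=
  ∀ (x : P.Inst) (ε : ℝ), 0 < ε → ε < 1 → P.ApproxLikely x ε (M (ε :: P.enc x))

end MaxProblem

/-! ### Randomized oracle machines over the reals

The model is that of Blum, Shub and Smale (a multi-stack real machine with unit-cost exact
arithmetic and comparison, and finitely many real constants in its program), with coin flips and
an oracle. Programs are finite syntax trees, so a program uses only finitely many stacks. -/

inductive ArithOp where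
  | add | sub | mul | div

def ArithOp.eval : ArithOp → ℝ → ℝ → ℝ
  | .add, a, b => a + b
  | .sub, a, b => a - b
  | .mul, a, b => a * b
  | .div, a, b => a / b

/-- Tests: stack `i` is nonempty; stack `i` is nonempty and its top is positive. -/
inductive Test where
  | nonempty (i : ℕ)
  | pos (i : ℕ)

/-- The contents of the stacks; the head of the list is the top of the stack. -/
abbrev Store := ℕ → List ℝ

def Test.Holds (s : Store) : Test → Prop
  | .nonempty i => s i ≠ []
  | .pos i => ∃ a l, s i = a :: l ∧ 0 < a

inductive Prog where
  /-- do nothing -/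
  | skip
  /-- push the constant `c` on stack `i` -/
  | push (i : ℕ) (c : ℝ)
  /-- remove the top of stack `i` -/
  | pop (i : ℕ)
  /-- push the top of stack `i` on stack `j` -/
  | copy (i j : ℕ)
  /-- replace the two top cells `b, a` of stack `i` (`b` on top) by `a op b` -/
  | arith (op : ArithOp) (i : ℕ)
  /-- push a fair random bit on stack `i` -/
  | flip (i : ℕ)
  /-- call the oracle -/
  | query
  | seq (p q : Prog)
  | cond (t : Test) (p q : Prog)
  | loop (t : Test) (p : Prog)

/-- A configuration: the list of programs still to be run, and the store. The machine has halted
when that list is empty. -/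
abbrev Cfg := List Prog × Store

def bit (b : Bool) : ℝ := if b then 1 else 0

def copyTop (i j : ℕ) (s : Store) : Store :=
  match s i with
  | [] => s
  | a :: _ => Function.update s j (a :: s j)

def arithTop (op : ArithOp) (i : ℕ) (s : Store) : Store :=
  match s i with
  | b :: a :: l => Function.update s i (op.eval a b :: l)
  | _ => s

open Classical in
/-- One step with the oracle `M`. An oracle call draws a fresh answer of `M` on the contents of
stack `1`, erases stack `1` and writes the answer on stack `2` in place of its old contents. -/
def step (M : List ℝ → PMF (List Bool)) : Cfg → PMF Cfg
  | ([], s) => PMF.pure ([], s)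
  | (.skip :: K, s) => PMF.pure (K, s)
  | (.push i c :: K, s) => PMF.pure (K, Function.update s i (c :: s i))
  | (.pop i :: K, s) => PMF.pure (K, Function.update s i (s i).tail)
  | (.copy i j :: K, s) => PMF.pure (K, copyTop i j s)
  | (.arith op i :: K, s) => PMF.pure (K, arithTop op i s)
  | (.flip i :: K, s) =>
      (PMF.uniformOfFintype Bool).map fun b => (K, Function.update s i (bit b :: s i))
  | (.query :: K, s) =>
      (M (s 1)).map fun y => (K, Function.update (Function.update s 1 []) 2 (y.map bit))
  | (.seq p q :: K, s) => PMF.pure (p :: q :: K, s)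
  | (.cond t p q :: K, s) => PMF.pure (if t.Holds s then p :: K else q :: K, s)
  | (.loop t p :: K, s) => PMF.pure (if t.Holds s then p :: .loop t p :: K else K, s)

/-- The distribution of the configuration after `t` steps. -/
def run (M : List ℝ → PMF (List Bool)) : ℕ → Cfg → PMF Cfg
  | 0, c => PMF.pure c
  | t + 1, c => (step M c).bind (run M t)

/-- Initially the input is on stack `0` and all other stacks are empty. -/
def initCfg (N : Prog) (input : List ℝ) : Cfg :=
  ([N], Function.update (fun _ => []) 0 input)

/-- The output is the bit string on stack `3` (positive cells are read as `1`). -/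
def readOutput (c : Cfg) : List Bool := (c.2 3).map fun r => decide (0 < r)

/-- The value at `(|x|, 1/ε)` of a polynomial in two variables. -/
def polyVal (p : MvPolynomial (Fin 2) ℝ) (n : ℕ) (ε : ℝ) : ℝ :=
  MvPolynomial.eval ![(n : ℝ), 1 / ε] p

/-- Polynomial-time randomized approximation-preserving Turing reducibility of `P` to `Q`. -/
def APTReduces (P Q : MaxProblem) : Prop :=
  ∃ (N : Prog) (p q : MvPolynomial (Fin 2) ℝ),
    ∀ M : List ℝ → PMF (List Bool), Q.IsApproxScheme M →
    ∀ (x : P.Inst) (ε : ℝ), 0 < ε → ε < 1 →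
      -- every oracle call is `(w, δ)` with `δ ∈ (0,1)` and `1/δ ≤ p(|x|, 1/ε)`
      (∀ t, ∀ c ∈ (run M t (initCfg N (ε :: P.enc x))).support,
        c.1.head? = some Prog.query →
          ∃ (w : Q.Inst) (δ : ℝ), 0 < δ ∧ δ < 1 ∧ c.2 1 = δ :: Q.enc w ∧
            1 / δ ≤ polyVal p (P.size x) ε) ∧
      -- on every computation path `N` halts within `q(|x|, 1/ε)` steps, and its output is
      -- a `2^ε`-approximate solution with probability at least `3/4`
      ∃ t : ℕ, (t : ℝ) ≤ polyVal q (P.size x) ε ∧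
        (∀ c ∈ (run M t (initCfg N (ε :: P.enc x))).support, c.1 = []) ∧
        P.ApproxLikely x ε ((run M t (initCfg N (ε :: P.enc x))).map readOutput)

/-! ### Product constraint satisfaction problems -/

/-- An element `⟨h, (x_{i_1}, …, x_{i_k})⟩`: a constraint applied to variables among
`x_0, …, x_{n-1}`. -/
structure Application (n : ℕ) where
  con : Constraint
  scope : Fin con.arity → Fin n

/-- An instance of `MAX-PROD-CSP(F)`: a number `n` of variables and a finite set `H` of
applications of constraints of `F`, the set being listed without repetition. -/
structure CSPInst (F : Set Constraint) where
  n : ℕ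
  H : List (Application n)
  nodup : H.Nodup
  mem : ∀ a ∈ H, a.con ∈ F

/-- The values of a function on `{0,1}^k` in the lexicographic order of the arguments. -/
def table : (k : ℕ) → ((Fin k → Bool) → ℝ≥0) → List ℝ
  | 0, h => [(h Fin.elim0 : ℝ)]
  | k + 1, h => table k (fun x => h (Fin.cons false x)) ++ table k (fun x => h (Fin.cons true x))

/-- The arity of the constraint, its table of values, and the indices of the variables. -/
def Application.enc {n : ℕ} (a : Application n) : List ℝ :=
  (a.con.arity : ℝ) ::
    (table a.con.arity a.con.val ++ List.ofFn fun j => ((a.scope j : ℕ) : ℝ))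

/-- The number of variables in unary, and the list of applications. -/
def CSPInst.enc {F : Set Constraint} (x : CSPInst F) : List ℝ :=
  List.replicate x.n 1 ++ 0 :: x.H.flatMap Application.enc

/-- The truth assignment given by a bit string. -/
def assignment (n : ℕ) (y : List Bool) (i : Fin n) : Bool := y.getD i false

/-- The product of the values of all constraints under the assignment `y`. -/
def CSPInst.value {F : Set Constraint} (x : CSPInst F) (y : List Bool) : ℝ≥0 :=
  (x.H.map fun a => a.con.val fun j => assignment x.n y (a.scope j)).prod

theorem table_length (k : ℕ) (h : (Fin k → Bool) → ℝ≥0) : (table k h).length = 2 ^ k := by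
  induction k with
  | zero => simp [table]
  | succ k ih => simp [table, ih, pow_succ]; ring

theorem table_injective (k : ℕ) : Function.Injective (table k) := by
  induction k with
  | zero =>
    intro h h' e
    funext x
    simp only [table, List.cons.injEq, NNReal.coe_inj, and_true] at e
    rw [Subsingleton.elim x Fin.elim0, e]
  | succ k ih =>
    intro h h' e
    simp only [table] at e
    obtain ⟨e0, e1⟩ := List.append_inj e (by simp [table_length])
    funext x
    rw [← Fin.cons_self_tail x]
    cases x 0
    · exact congrFun (ih e0) (Fin.tail x)
    · exact congrFun (ih e1) (Fin.tail x)

theorem Application.enc_append_inj {n : ℕ} (a b : Application n) (l l' : List ℝ)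
    (e : a.enc ++ l = b.enc ++ l') : a = b ∧ l = l' := by
  obtain ⟨⟨k, h⟩, v⟩ := a
  obtain ⟨⟨k', h'⟩, v'⟩ := b
  simp only [Application.enc, List.cons_append, List.cons.injEq, Nat.cast_inj,
    List.append_assoc] at e
  obtain ⟨rfl, e⟩ := e
  obtain ⟨e0, e⟩ := List.append_inj e (by simp [table_length])
  obtain ⟨e1, e2⟩ := List.append_inj e (by simp)
  obtain rfl := table_injective _ e0
  have hv : v = v' := by
    funext j
    have := congrFun (List.ofFn_injective e1) j
    exact Fin.ext (by exact_mod_cast this)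
  subst hv
  exact ⟨rfl, e2⟩

theorem flatMap_enc_injective {n : ℕ} :
    Function.Injective fun H : List (Application n) => H.flatMap Application.enc := by
  intro H
  induction H with
  | nil =>
    intro H' e
    cases H' with
    | nil => rfl
    | cons b H' => simp [Application.enc] at e
  | cons a H ih =>
    intro H' e
    cases H' with
    | nil => simp [Application.enc] at e
    | cons b H' =>
      simp only [List.flatMap_cons] at e
      obtain ⟨rfl, e'⟩ := Application.enc_append_inj _ _ _ _ e
      rw [ih e']

theorem replicate_append_inj (n n' : ℕ) (l l' : List ℝ)
    (e : List.replicate n (1 : ℝ) ++ 0 :: l = List.replicate n' 1 ++ 0 :: l') :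
    n = n' ∧ l = l' := by
  induction n generalizing n' with
  | zero =>
    cases n' with
    | zero => simpa using e
    | succ n' => simp [List.replicate_succ] at e
  | succ n ih =>
    cases n' with
    | zero => simp [List.replicate_succ] at e
    | succ n' =>
      simp only [List.replicate_succ, List.cons_append, List.cons.injEq, true_and] at e
      obtain ⟨h, h'⟩ := ih n' e
      exact ⟨by rw [h], h'⟩

theorem CSPInst.enc_injective (F : Set Constraint) :
    Function.Injective (CSPInst.enc (F := F)) := by
  intro x y e
  obtain ⟨n, H, _, _⟩ := x
  obtain ⟨n', H', _, _⟩ := y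
  obtain ⟨h, e⟩ := replicate_append_inj _ _ _ _ e
  simp only at h
  subst h
  obtain rfl := flatMap_enc_injective e
  rfl

/-- `MAX-PROD-CSP(F)`. -/
def maxProdCSP (F : Set Constraint) : MaxProblem where
  Inst := CSPInst F
  enc := CSPInst.enc
  enc_injective := CSPInst.enc_injective F
  Sol x := {y | y.length = x.n}
  measure x y := if y.length = x.n then x.value y else 0

/-- `MAX-PROD-CSP*(F) = MAX-PROD-CSP(F ∪ U)`: all unary constraints are available for free. -/
def maxProdCSPStar (F : Set Constraint) : MaxProblem := maxProdCSP (F ∪ U)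

end MaxProd

end

/-!
A relation closed under `x + y + z` is affine, and a relation closed under `x ∧ y` and `x ∨ y` is a
conjunction of pins and implications. So the support of `f` contains incomparable `x` and `y` for
which `x ∧ y` or `x ∨ y` is missing. Pinning the positions where `x` and `y` agree, and identifying
those where `(x, y)` is `(0, 1)` and those where it is `(1, 0)`, leaves a binary relation.

If just one of `x ∧ y` and `x ∨ y` is missing, this relation is `OR` or `NAND`, and it forbids a
pair `(b, b)`. Every application in the simulation should contain a fresh variable, lest it coincide
with another element of the set `H`. So the arguments `a` and `c` are joined by a path `a`, `z`,
`z'`, `c` of three applications, in which `z` and `z'` have a large weight `W` on the value `b`: the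
optimum over `z` and `z'` is of order `W` unless `a = c = b`, when it is bounded, and unary weights
at `a` and `c` make the three large values equal.

If both are missing, the relation is the disequality, which makes negations of variables available.
From `u`, `v`, `w` in the support of `f` whose sum is not in it one reads off which literals to
substitute in `f` to get `NAND`.

In an instance a violated application of `OR` or `NAND` thus costs a factor of order `W` instead of
making the product vanish. Let `P` be a product that bounds the value of every solution and the
inverse of every nonzero one. Once `W` exceeds a constant times `P ^ 2`, a solution that violates an
application is far from optimal. Hence a `2 ^ ε`-approximate solution of the simulating instance is
one of the original instance on the original variables. A machine with exact arithmetic computes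
such a `W` in one pass over the input, replaces the applications one after the other and queries the
oracle once, with the same `ε`.
-/

open scoped NNReal ENNReal

noncomputable section

namespace MaxProd

/-! ### Affine relations and conjunctions of implications -/

theorem exists_matrix_mulVec_eq_iff_mem {K : Type*} [Field K] {k : ℕ}
    (S : AffineSubspace K (Fin k → K)) :
    ∃ (m : ℕ) (A : Matrix (Fin m) (Fin k) K) (b : Fin m → K), ∀ v, A.mulVec v = b ↔ v ∈ S := by
  rcases S.eq_bot_or_nonempty with rfl | ⟨r, hr⟩
  · refine ⟨1, 0, fun _ => 1, fun v => ?_⟩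
    simp only [Matrix.zero_mulVec, AffineSubspace.notMem_bot, iff_false]
    exact fun e => zero_ne_one (congrFun e 0)
  · let B := Module.finBasis K ((Fin k → K) ⧸ S.direction)
    let φ := B.equivFun.toLinearMap ∘ₗ S.direction.mkQ
    have ker_φ (v) : φ v = 0 ↔ v ∈ S.direction := by simp [φ]
    refine ⟨_, LinearMap.toMatrix' φ, φ r, fun v => ?_⟩
    rw [LinearMap.toMatrix'_mulVec, ← sub_eq_zero, ← map_sub, ker_φ, ← vsub_eq_sub,
      S.vsub_right_mem_direction_iff_mem hr]

theorem toF2_injective : Function.Injective toF2 := by decide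

theorem toF2_xor (x y z : Bool) : toF2 (x ^^ (y ^^ z)) = toF2 x - toF2 y + toF2 z := by
  cases x <;> cases y <;> cases z <;> decide

theorem isAffine_of_xor_closed {k : ℕ} (R : Set (Fin k → Bool))
    (h : ∀ x ∈ R, ∀ y ∈ R, ∀ z ∈ R, (fun l => x l ^^ (y l ^^ z l)) ∈ R) : IsAffine R := by
  let S : AffineSubspace (ZMod 2) (Fin k → ZMod 2) :=
    { carrier := (fun x l => toF2 (x l)) '' R
      smul_vsub_vadd_mem' := by
        rintro c _ _ _ ⟨x, hx, rfl⟩ ⟨y, hy, rfl⟩ ⟨z, hz, rfl⟩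
        obtain rfl | rfl : c = 0 ∨ c = 1 := by revert c; decide
        · exact ⟨z, hz, by simp⟩
        · exact ⟨_, h x hx y hy z hz, by ext l; simp [toF2_xor]⟩ }
  obtain ⟨m, A, b, hA⟩ := exists_matrix_mulVec_eq_iff_mem S
  refine ⟨m, A, b, Set.ext fun x => ?_⟩
  exact (toF2_injective.comp_left.mem_set_image.symm).trans (hA _).symm

theorem exists_mem_forall_eq_bot {ι α : Type*} [SemilatticeInf α] [OrderBot α]
    {R : Set (ι → α)} (hR : InfClosed R) (hne : R.Nonempty) (S : Finset ι)
    (h : ∀ i ∈ S, ∃ y ∈ R, y i = ⊥) : ∃ y ∈ R, ∀ i ∈ S, y i = ⊥ := by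
  choose! y hyR hy using h
  rcases S.eq_empty_or_nonempty with rfl | hS
  · exact hne.imp fun y hy => ⟨hy, by simp⟩
  · refine ⟨S.inf' hS y, hR.finsetInf'_mem hS hyR, fun i hi => ?_⟩
    exact le_bot_iff.1 ((S.inf'_le y hi i).trans_eq (hy i hi))

theorem exists_mem_forall_eq_top {ι α : Type*} [SemilatticeSup α] [OrderTop α]
    {R : Set (ι → α)} (hR : SupClosed R) (hne : R.Nonempty) (S : Finset ι)
    (h : ∀ i ∈ S, ∃ y ∈ R, y i = ⊤) : ∃ y ∈ R, ∀ i ∈ S, y i = ⊤ :=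
  exists_mem_forall_eq_bot (α := αᵒᵈ) (R := R) hR hne S h

theorem mem_of_isSublattice {k : ℕ} [NeZero k] {R : Set (Fin k → Bool)} (hR : IsSublattice R)
    {x : Fin k → Bool} (h0 : ∀ j, x j = false → ∃ y ∈ R, y j = false)
    (h1 : ∀ i, x i = true → ∃ y ∈ R, y i = true)
    (h10 : ∀ i j, x i = true → x j = false → ∃ y ∈ R, y i = true ∧ y j = false) : x ∈ R := by
  let zeros : Finset (Fin k) := {j | x j = false}
  let ones : Finset (Fin k) := {i | x i = true}
  have below_of_zeros {y : Fin k → Bool} (hy : ∀ j ∈ zeros, y j = false) : y ≤ x := fun j => by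
    cases hj : x j with
    | false => exact (hy j (by simpa [zeros] using hj)).le
    | true => exact le_top
  -- `x` is the join of these members of `R`, each the meet of the members provided by `h10`.
  have exists_below (i) (hi : x i = true) : ∃ y ∈ R ∩ Set.Iic x, y i = true := by
    obtain ⟨y, ⟨hy, hyi⟩, hyz⟩ := exists_mem_forall_eq_bot (R := R ∩ {y | y i = true})
      (hR.infClosed.inter fun y hy z hz => by
        simp only [Set.mem_ofPred_eq] at hy hz ⊢
        simp [hy, hz])
      (h1 i hi) zeros fun j hj => by
        obtain ⟨y, hy, hyi, hyj⟩ := h10 i j hi (by simpa [zeros] using hj)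
        exact ⟨y, ⟨hy, hyi⟩, hyj⟩
    exact ⟨y, ⟨hy, below_of_zeros hyz⟩, hyi⟩
  have nonempty_below : (R ∩ Set.Iic x).Nonempty := by
    by_cases hx : ∃ i, x i = true
    · obtain ⟨i, hi⟩ := hx
      obtain ⟨y, hy, -⟩ := exists_below i hi
      exact ⟨y, hy⟩
    · have hx0 (j) : x j = false := by simpa using not_exists.1 hx j
      obtain ⟨y₀, hy₀, -⟩ := h0 0 (hx0 0)
      obtain ⟨y, hy, hyz⟩ := exists_mem_forall_eq_bot hR.infClosed ⟨y₀, hy₀⟩ zeros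
        fun j _ => h0 j (hx0 j)
      exact ⟨y, hy, below_of_zeros hyz⟩
  have supClosed_below : SupClosed (R ∩ Set.Iic x) :=
    hR.supClosed.inter fun _ hu _ hv => Set.mem_Iic.2 (sup_le hu hv)
  obtain ⟨y, ⟨hy, hyx⟩, hyo⟩ := exists_mem_forall_eq_top supClosed_below nonempty_below ones
    fun i hi => exists_below i (by simpa [ones] using hi)
  have hxy : x ≤ y := fun i => by
    cases hi : x i with
    | false => exact bot_le
    | true => exact (hyo i (by simpa [ones] using hi)).ge
  rwa [hxy.antisymm hyx]

theorem ImpAtom.finite_univ (k : ℕ) : (Set.univ : Set (ImpAtom k)).Finite := by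
  refine ((Set.finite_range ImpAtom.delta0).union ((Set.finite_range ImpAtom.delta1).union
    (Set.finite_range fun p : Fin k × Fin k => ImpAtom.implies p.1 p.2))).subset ?_
  rintro (i | i | ⟨i, j⟩) - <;> simp

theorem exists_impAtoms_of_isSublattice {k : ℕ} [NeZero k] {R : Set (Fin k → Bool)}
    (hR : IsSublattice R) :
    ∃ L : List (ImpAtom k), L ≠ [] ∧ R = {x | ∀ a ∈ L, a.Holds x} := by
  let valid : Set (ImpAtom k) := {a | ∀ x ∈ R, a.Holds x}
  let L := ((ImpAtom.finite_univ k).subset (Set.subset_univ valid)).toFinset.toList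
  have mem_L (a) : a ∈ L ↔ ∀ x ∈ R, a.Holds x := by simp [L, valid]
  refine ⟨L, List.ne_nil_of_mem (a := .implies 0 0) (by simp [mem_L, ImpAtom.Holds]),
    Set.ext fun x => ⟨fun hx a ha => (mem_L a).1 ha x hx, fun hx => ?_⟩⟩
  refine mem_of_isSublattice hR (fun j hj => ?_) (fun i hi => ?_) (fun i j hi hj => ?_) <;>
    by_contra! hR'
  · have := hx (.delta1 j) ((mem_L _).2 fun y hy => by simpa [ImpAtom.Holds] using hR' y hy)
    simp [ImpAtom.Holds, hj] at this
  · have := hx (.delta0 i) ((mem_L _).2 fun y hy => by simpa [ImpAtom.Holds] using hR' y hy)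
    simp [ImpAtom.Holds, hi] at this
  · have := hx (.implies i j) ((mem_L _).2 fun y hy hyi => by simpa using hR' y hy hyi)
    simp [ImpAtom.Holds, hi, hj] at this

theorem Constraint.exists_xor_notMem_support {f : Constraint} (hf : ¬ f.HasAffineSupport) :
    ∃ x ∈ f.support, ∃ y ∈ f.support, ∃ z ∈ f.support,
      (fun l => x l ^^ (y l ^^ z l)) ∉ f.support := by
  by_contra! h
  exact hf (isAffine_of_xor_closed _ h)

theorem Constraint.exists_inf_or_sup_notMem_support {f : Constraint} (hAff : ¬ f.HasAffineSupport)
    (hImp : ¬ f.HasImpSupport) :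
    ∃ x ∈ f.support, ∃ y ∈ f.support, x ⊓ y ∉ f.support ∨ x ⊔ y ∉ f.support := by
  have arity_ne_zero : f.arity ≠ 0 := fun h0 => hAff <| isAffine_of_xor_closed _
    fun x hx y _ z _ => by
      have : IsEmpty (Fin f.arity) := by rw [h0]; infer_instance
      rwa [Subsingleton.elim (fun l => _) x]
  have : NeZero f.arity := ⟨arity_ne_zero⟩
  by_contra! h
  exact hImp (exists_impAtoms_of_isSublattice
    ⟨fun x hx y hy => (h x hx y hy).2, fun x hx y hy => (h x hx y hy).1⟩)

/-! ### Gadgets -/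

/-- The binary constraint with value `0` at `(b, b)` and value `1` elsewhere: `OR` for `b = false`
and `NAND` for `b = true`. -/
def forbid (b : Bool) : Constraint := ⟨2, fun x => if x 0 = b ∧ x 1 = b then 0 else 1⟩

theorem forbid_false : forbid false = OR := rfl

theorem forbid_true : forbid true = NAND := rfl

/-- The shape of a gadget made from a constraint of arity `k` and unary constraints. The local
variables `0` and `1` are the arguments of the gadget, and `l + 2` for `l < aux` is an auxiliary
variable with the unary weight `c + d * W`, where `(c, d)` is given by `weight l` and `W` is a large
parameter. The numbers `left` and `right` are unary weights of the two arguments. -/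
structure Template (k : ℕ) where
  aux : ℕ
  scopes : List (Fin k → ℕ)
  weight : ℕ → Bool → ℝ≥0 × ℝ≥0
  left : ℝ≥0
  right : ℝ≥0

/-- The total weight of an assignment `τ` of the local variables; the weights `left` and `right`
count when the respective argument has the value `b`. -/
def Template.val {k : ℕ} (T : Template k) (h : (Fin k → Bool) → ℝ≥0) (b : Bool) (W : ℝ≥0)
    (τ : ℕ → Bool) : ℝ≥0 :=
  (T.scopes.map fun s => h fun j => τ (s j)).prod *
    ((List.range T.aux).map fun l =>
      (T.weight l (τ (l + 2))).1 + (T.weight l (τ (l + 2))).2 * W).prod *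
    ((if τ 0 = b then T.left else 1) * (if τ 1 = b then T.right else 1))

/-- A gadget that simulates `κ * W * forbid b` by applications of `f` and unary constraints: the
simulation is exact at the allowed arguments, and at `(b, b)` the weight stays bounded by `D`
instead of vanishing. The scopes have to be distinct even when both arguments are the same variable,
since the applications of a constraint in an instance form a set. -/
structure Gadget (f : Constraint) (b : Bool) extends Template f.arity where
  κ : ℝ≥0
  D : ℝ≥0
  two_le : 2 ≤ aux
  arity_ne : f.arity ≠ 1
  scope_lt : ∀ s ∈ scopes, ∀ j, s j < aux + 2
  fresh : ∀ s ∈ scopes, ∃ j, 2 ≤ s j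
  nodup : (scopes.map fun s j => if s j = 1 then 0 else s j).Nodup
  κ_pos : 0 < κ
  one_le_D : 1 ≤ D
  val_le : ∀ W, D ≤ W → ∀ τ : ℕ → Bool, ¬ (τ 0 = b ∧ τ 1 = b) →
    toTemplate.val f.val b W τ ≤ κ * W
  exists_val_eq : ∀ W, D ≤ W → ∀ x y : Bool, ¬ (x = b ∧ y = b) → ∃ τ : ℕ → Bool,
    τ 0 = x ∧ τ 1 = y ∧ toTemplate.val f.val b W τ = κ * W
  val_le_of_forbidden : ∀ W, D ≤ W → ∀ τ : ℕ → Bool, τ 0 = b → τ 1 = b →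
    toTemplate.val f.val b W τ ≤ D

/-! ### Binary restrictions of a relation -/

/-- The choice among `z`, `p`, `q`, `r` by the bits `00`, `01`, `10`, `11`. -/
def select {α : Type*} (a b : Bool) (z p q r : α) : α :=
  if a then (if b then r else q) else (if b then p else z)

theorem apply_select {α β : Type*} (g : α → β) (a b : Bool) (z p q r : α) :
    g (select a b z p q r) = select a b (g z) (g p) (g q) (g r) := by
  cases a <;> cases b <;> rfl

section Mix

variable {ι : Type*}

/-- The tuple that agrees with `x` and `y` where these agree, and otherwise takes the value `a`
where `(x, y)` is `(0, 1)` and the value `c` where it is `(1, 0)`. -/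
def mix (x y : ι → Bool) (a c : Bool) : ι → Bool := fun l => select (x l) (y l) false a c true

/-- The scope that restricts a constraint along `mix`, with the local variables `u` and `v` in the
places of `a` and `c`; the local variables `2` and `3` are meant to have the values `0` and `1`. -/
def mixScope (x y : ι → Bool) (u v : ℕ) : ι → ℕ := fun l => select (x l) (y l) 2 u v 3

variable (x y : ι → Bool)

theorem mix_false_true : mix x y false true = x := by
  funext l
  cases hx : x l <;> cases hy : y l <;> simp [mix, select, hx, hy]

theorem mix_true_false : mix x y true false = y := by
  funext l
  cases hx : x l <;> cases hy : y l <;> simp [mix, select, hx, hy]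

theorem mix_false_false : mix x y false false = x ⊓ y := by
  funext l
  cases hx : x l <;> cases hy : y l <;> simp [mix, select, hx, hy]

theorem mix_true_true : mix x y true true = x ⊔ y := by
  funext l
  cases hx : x l <;> cases hy : y l <;> simp [mix, select, hx, hy]

theorem comp_mixScope {τ : ℕ → Bool} (h2 : τ 2 = false) (h3 : τ 3 = true) (u v : ℕ) :
    (fun l => τ (mixScope x y u v l)) = mix x y (τ u) (τ v) := by
  funext l
  simp only [mixScope, apply_select τ, h2, h3, mix]

theorem mixScope_lt {u v n : ℕ} (hu : u < n) (hv : v < n) (hn : 4 ≤ n) (l : ι) :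
    mixScope x y u v l < n := by
  unfold mixScope select
  split_ifs <;> omega

theorem identify_mixScope (u v : ℕ) :
    (fun l => if mixScope x y u v l = 1 then 0 else mixScope x y u v l) =
      mixScope x y (if u = 1 then 0 else u) (if v = 1 then 0 else v) := by
  funext l
  exact apply_select (fun u : ℕ => if u = 1 then 0 else u) _ _ 2 u v 3

variable {x y}

theorem exists_true_false_of_not_le (h : ¬ x ≤ y) : ∃ l, x l = true ∧ y l = false := by
  obtain ⟨l, hl⟩ := not_forall.1 h
  exact ⟨l, by revert hl; cases x l <;> cases y l <;> simp⟩

theorem mixScope_inj (h : IncompRel (· ≤ ·) x y) {u v u' v' : ℕ} :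
    mixScope x y u v = mixScope x y u' v' ↔ u = u' ∧ v = v' := by
  refine ⟨fun e => ?_, by rintro ⟨rfl, rfl⟩; rfl⟩
  obtain ⟨l, hx, hy⟩ := exists_true_false_of_not_le h.1
  obtain ⟨l', hy', hx'⟩ := exists_true_false_of_not_le h.2
  exact ⟨by simpa [mixScope, select, hx', hy'] using congrFun e l',
    by simpa [mixScope, select, hx, hy] using congrFun e l⟩

theorem exists_two_le_mixScope (h : IncompRel (· ≤ ·) x y) {u v : ℕ} (huv : 2 ≤ u ∨ 2 ≤ v) :
    ∃ l, 2 ≤ mixScope x y u v l := by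
  rcases huv with hu | hv
  · obtain ⟨l, hy, hx⟩ := exists_true_false_of_not_le h.2
    exact ⟨l, by simpa [mixScope, select, hx, hy] using hu⟩
  · obtain ⟨l, hx, hy⟩ := exists_true_false_of_not_le h.1
    exact ⟨l, by simpa [mixScope, select, hx, hy] using hv⟩

end Mix

theorem arity_ne_one_of_incompRel {k : ℕ} {x y : Fin k → Bool} (h : IncompRel (· ≤ ·) x y) :
    k ≠ 1 := by
  rintro rfl
  obtain ⟨l, hx, -⟩ := exists_true_false_of_not_le h.1
  obtain ⟨l', -, hx_false⟩ := exists_true_false_of_not_le h.2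
  rw [Subsingleton.elim l' l] at hx_false
  simp [hx] at hx_false

/-! ### The gadget for a binary restriction with one forbidden constant pair -/

/-- The weight of the path `a`, `z`, `z'`, `c` with the binary weight `p` on its edges, the weight
`W` for each inner vertex of value `b`, and `left` and `right` for the ends of value `b`. -/
def pathWeight (p : Bool → Bool → ℝ≥0) (b : Bool) (left right W : ℝ≥0) (a c z z' : Bool) : ℝ≥0 :=
  p a z * p z z' * p z' c * ((if z = b then W else 1) * (if z' = b then W else 1)) *
    ((if a = b then left else 1) * (if c = b then right else 1))

section Path

variable {p : Bool → Bool → ℝ≥0} {b : Bool}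

-- A path of nonzero weight has no two adjacent vertices of value `b`; its weight has the factor `W`
-- if one of its inner vertices has value `b`, and this is impossible when both ends do.
theorem pathWeight_eq (hbb : p b b = 0) (hnn : p (!b) (!b) ≠ 0)
    (hbn : p b (!b) ≠ 0) (hnb : p (!b) b ≠ 0) (W : ℝ≥0) (a c z z' : Bool) :
    let w := pathWeight p b (p (!b) (!b) / p b (!b)) (p (!b) (!b) / p (!b) b) W a c z z'
    w = 0 ∨ w = p (!b) (!b) ^ 3 ∨
      ¬ (a = b ∧ c = b) ∧ w = p (!b) (!b) * p b (!b) * p (!b) b * W := by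
  intro w
  simp only [w, pathWeight]
  cases b <;> simp only [Bool.not_false, Bool.not_true] at * <;>
    cases a <;> cases c <;> cases z <;> cases z' <;> simp [hbb] <;> field_simp <;> simp

theorem exists_pathWeight_eq (hnn : p (!b) (!b) ≠ 0) (hbn : p b (!b) ≠ 0) (hnb : p (!b) b ≠ 0)
    (W : ℝ≥0) {a c : Bool} (hac : ¬ (a = b ∧ c = b)) :
    ∃ z z', pathWeight p b (p (!b) (!b) / p b (!b)) (p (!b) (!b) / p (!b) b) W a c z z' =
      p (!b) (!b) * p b (!b) * p (!b) b * W := by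
  refine ⟨if a = b then !b else b, if a = b then b else !b, ?_⟩
  simp only [pathWeight]
  cases b <;> simp only [Bool.not_false, Bool.not_true] at * <;>
    cases a <;> cases c <;> simp at hac ⊢ <;> field_simp <;> simp

end Path

section PathGadget

variable {k : ℕ} (x y : Fin k → Bool) (b : Bool)

/-- Pins the local variables `2` and `3` to `0` and `1`, and favours the value `b` of the others. -/
def pathUnary : ℕ → Bool → ℝ≥0 × ℝ≥0
  | 0, c => if c then (0, 0) else (1, 0)
  | 1, c => if c then (1, 0) else (0, 0)
  | _, c => if c = b then (0, 1) else (1, 0)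

/-- The gadget that joins its arguments by a path of three restricted applications. -/
def pathTemplate (left right : ℝ≥0) : Template k :=
  ⟨4, [mixScope x y 0 4, mixScope x y 4 5, mixScope x y 5 1], pathUnary b, left, right⟩

theorem pathTemplate_val (h : (Fin k → Bool) → ℝ≥0) (left right W : ℝ≥0) (τ : ℕ → Bool) :
    (pathTemplate x y b left right).val h b W τ =
      if τ 2 = false ∧ τ 3 = true then
        pathWeight (fun a c => h (mix x y a c)) b left right W (τ 0) (τ 1) (τ 4) (τ 5)
      else 0 := by
  have range_four : List.range 4 = [0, 1, 2, 3] := rfl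
  simp only [pathTemplate, Template.val, range_four, List.map_cons, List.map_nil, List.prod_cons,
    List.prod_nil, pathUnary]
  by_cases h2 : τ 2 = false
  · by_cases h3 : τ 3 = true
    · simp only [comp_mixScope x y h2 h3, h2, h3, pathWeight]
      by_cases h4 : τ 4 = b <;> by_cases h5 : τ 5 = b <;> simp [h4, h5, mul_assoc]
    · simp [h3]
  · simp [h2]

variable {x y}

theorem pathTemplate_nodup (hxy : IncompRel (· ≤ ·) x y) (left right : ℝ≥0) :
    ((pathTemplate x y b left right).scopes.map fun s j =>
      if s j = 1 then 0 else s j).Nodup := by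
  simp [pathTemplate, identify_mixScope, mixScope_inj hxy]

theorem pathTemplate_scope_lt (left right : ℝ≥0) :
    ∀ s ∈ (pathTemplate x y b left right).scopes, ∀ j, s j < 6 := by
  simp only [pathTemplate, List.forall_mem_cons]
  refine ⟨?_, ?_, ?_, by simp⟩ <;> exact mixScope_lt x y (by decide) (by decide) (by decide)

theorem pathTemplate_fresh (hxy : IncompRel (· ≤ ·) x y) (left right : ℝ≥0) :
    ∀ s ∈ (pathTemplate x y b left right).scopes, ∃ j, 2 ≤ s j := by
  simp only [pathTemplate, List.forall_mem_cons]
  refine ⟨?_, ?_, ?_, by simp⟩ <;> exact exists_two_le_mixScope hxy (by decide)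

variable {b}

theorem exists_gadget_of_forbidden_pair {f : Constraint} {x y : Fin f.arity → Bool}
    (hxy : IncompRel (· ≤ ·) x y) (hbb : f.val (mix x y b b) = 0)
    (hnn : f.val (mix x y (!b) (!b)) ≠ 0) (hbn : f.val (mix x y b (!b)) ≠ 0)
    (hnb : f.val (mix x y (!b) b) ≠ 0) : Nonempty (Gadget f b) := by
  let p (a c : Bool) : ℝ≥0 := f.val (mix x y a c)
  let α := p (!b) (!b)
  let β := p b (!b)
  let γ := p (!b) b
  let T := pathTemplate x y b (α / β) (α / γ)
  have hα : 0 < α := pos_iff_ne_zero.2 hnn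
  have hβ : 0 < β := pos_iff_ne_zero.2 hbn
  have hγ : 0 < γ := pos_iff_ne_zero.2 hnb
  have T_val_cases (W τ) : T.val f.val b W τ = 0 ∨ T.val f.val b W τ = α ^ 3 ∨
      ¬ (τ 0 = b ∧ τ 1 = b) ∧ T.val f.val b W τ = α * β * γ * W := by
    rw [pathTemplate_val]
    split_ifs
    · exact pathWeight_eq (p := p) hbb hnn hbn hnb W _ _ _ _
    · exact .inl rfl
  refine ⟨{
    toTemplate := T
    κ := α * β * γ
    D := 1 + α ^ 3 + α ^ 2 / (β * γ)
    two_le := by simp [T, pathTemplate]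
    arity_ne := arity_ne_one_of_incompRel hxy
    κ_pos := by positivity
    one_le_D := by rw [add_assoc]; exact le_self_add
    nodup := pathTemplate_nodup b hxy _ _
    scope_lt := pathTemplate_scope_lt b _ _
    fresh := pathTemplate_fresh b hxy _ _
    val_le := fun W hW τ _ => ?_
    exists_val_eq := fun W _ a c hac => ?_
    val_le_of_forbidden := fun W _ τ h0 h1 => ?_ }⟩
  · rcases T_val_cases W τ with e | e | ⟨-, e⟩
    · exact e.trans_le zero_le
    · calc T.val f.val b W τ = α * β * γ * (α ^ 2 / (β * γ)) := by rw [e]; field_simp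
        _ ≤ α * β * γ * W := mul_le_mul_right (le_add_self.trans hW) _
    · exact e.le
  · obtain ⟨z, z', e⟩ := exists_pathWeight_eq (p := p) hnn hbn hnb W hac
    refine ⟨fun l => [a, c, false, true, z, z'].getD l false, rfl, rfl, ?_⟩
    rw [pathTemplate_val, if_pos ⟨rfl, rfl⟩]
    exact e
  · rcases T_val_cases W τ with e | e | ⟨h, -⟩
    · exact e.trans_le zero_le
    · exact e.trans_le (le_add_self.trans le_self_add)
    · exact absurd ⟨h0, h1⟩ h

end PathGadget

/-! ### The gadget for a constraint with a restriction to disequality -/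

/-- The literals over two variables and an existential variable `s`. -/
def literal (x y s : Bool) : Fin 8 → Bool := ![false, true, !x, x, !y, y, s, !s]

/-- The index of the complementary literal. -/
def literalNot : Fin 8 → Fin 8 := ![1, 0, 3, 2, 5, 4, 7, 6]

theorem literal_literalNot (x y s : Bool) (i : Fin 8) :
    literal x y s (literalNot i) = !literal x y s i := by
  revert x y s i
  decide

theorem exists_literals (T : Bool → Bool → Bool → Prop) (h000 : T false false false)
    (h011 : T false true true) (h101 : T true false true) (h110 : ¬ T true true false) :
    ∃ p q r : Fin 8, ∀ x y, (∃ s, T (literal x y s p) (literal x y s q) (literal x y s r)) ↔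
      ¬ (x = true ∧ y = true) := by
  by_cases h111 : T true true true
  · by_cases h001 : T false false true
    · by_cases h010 : T false true false
      · by_cases h100 : T true false false
        · exact ⟨3, 5, 0, by simp [literal, *]⟩
        · exact ⟨3, 0, 4, by simp [literal, *]⟩
      · exact ⟨0, 3, 4, by simp [literal, *]⟩
    · exact ⟨2, 4, 1, by simp [literal, *]⟩
  · exact ⟨3, 5, 6, by simp [literal, *]⟩

theorem exists_literal_scope {ι : Type*} {R : Set (ι → Bool)} {u v w : ι → Bool} (hu : u ∈ R)
    (hv : v ∈ R) (hw : w ∈ R) (huvw : (fun l => u l ^^ (v l ^^ w l)) ∉ R) :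
    ∃ i : ι → Fin 8, ∀ x y,
      (∃ s, (fun l => literal x y s (i l)) ∈ R) ↔ ¬ (x = true ∧ y = true) := by
  -- Translated by `u`, the four tuples restrict `R` to the ternary relation of `exists_literals`.
  let tuple (P Q S : Bool) : ι → Bool :=
    fun l => u l ^^ select (u l ^^ v l) (u l ^^ w l) false P Q S
  have tuple_eq {P Q S : Bool} {g : Bool → Bool → Bool → Bool}
      (h : ∀ a b c, (a ^^ select (a ^^ b) (a ^^ c) false P Q S) = g a b c) :
      tuple P Q S = fun l => g (u l) (v l) (w l) := funext fun l => h _ _ _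
  obtain ⟨p, q, r, hpqr⟩ := exists_literals (fun P Q S => tuple P Q S ∈ R)
    (by rwa [tuple_eq (g := fun a _ _ => a) (by decide)])
    (by rwa [tuple_eq (g := fun _ b _ => b) (by decide)])
    (by rwa [tuple_eq (g := fun _ _ c => c) (by decide)])
    (by rwa [tuple_eq (g := fun a b c => a ^^ (b ^^ c)) (by decide)])
  let i (l : ι) : Fin 8 := select (u l ^^ v l) (u l ^^ w l) 0 p q r
  refine ⟨fun l => if u l then literalNot (i l) else i l, fun x y => ?_⟩
  have literal_i (s : Bool) : (fun l => literal x y s (if u l then literalNot (i l) else i l)) =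
      tuple (literal x y s p) (literal x y s q) (literal x y s r) := by
    funext l
    have literal_il : literal x y s (i l) = select (u l ^^ v l) (u l ^^ w l) false
      (literal x y s p) (literal x y s q) (literal x y s r) := apply_select (literal x y s) ..
    simp only [tuple, ← literal_il]
    cases u l <;> simp [literal_literalNot]
  simp only [literal_i, hpqr]

theorem finite_range_of_dependsOn {ι α : Type*} {β : ι → Type*} {f : (∀ i, β i) → α} {s : Set ι}
    [Finite s] [∀ i, Finite (β i)] (hf : DependsOn f s) : (Set.range f).Finite := by
  rcases isEmpty_or_nonempty α with hα | hα
  · exact Set.toFinite _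
  · obtain ⟨g, rfl⟩ := dependsOn_iff_exists_comp.1 hf
    exact (Set.finite_range g).subset (Set.range_comp_subset_range _ _)

theorem exists_argument_weights {Q : (ℕ → Bool) → ℝ≥0} (hfin : (Set.range Q).Finite)
    (hQ : ∀ a c, ¬ (a = true ∧ c = true) → ∃ τ : ℕ → Bool, τ 0 = a ∧ τ 1 = c ∧ Q τ ≠ 0) :
    ∃ left right γ : ℝ≥0, 0 < γ ∧ ∀ a c, ¬ (a = true ∧ c = true) →
      IsGreatest ((fun τ : ℕ → Bool => Q τ *
        ((if τ 0 = true then left else 1) * (if τ 1 = true then right else 1))) ''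
          {τ | τ 0 = a ∧ τ 1 = c}) γ := by
  have exists_max (a c : Bool) (hac : ¬ (a = true ∧ c = true)) :
      ∃ γ, 0 < γ ∧ IsGreatest (Q '' {τ | τ 0 = a ∧ τ 1 = c}) γ := by
    obtain ⟨τ, h0, h1, hτ⟩ := hQ a c hac
    obtain ⟨γ, hγ, hle⟩ := Set.exists_max_image (Q '' {τ | τ 0 = a ∧ τ 1 = c}) id
      (hfin.subset (Set.image_subset_range _ _)) ⟨Q τ, τ, ⟨h0, h1⟩, rfl⟩
    exact ⟨γ, (pos_iff_ne_zero.2 hτ).trans_le (hle _ ⟨τ, ⟨h0, h1⟩, rfl⟩), hγ, hle⟩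
  obtain ⟨γ, hγ, hmax⟩ := exists_max false false (by decide)
  obtain ⟨γ₁, hγ₁, hmax₁⟩ := exists_max false true (by decide)
  obtain ⟨γ₂, hγ₂, hmax₂⟩ := exists_max true false (by decide)
  have scale {a c : Bool} {m r : ℝ≥0} (hmr : m * r = γ)
      (h : IsGreatest (Q '' {τ | τ 0 = a ∧ τ 1 = c}) m)
      (hr : r = (if a = true then γ / γ₂ else 1) * (if c = true then γ / γ₁ else 1)) :
      IsGreatest ((fun τ : ℕ → Bool => Q τ * ((if τ 0 = true then γ / γ₂ else 1) *
        (if τ 1 = true then γ / γ₁ else 1))) '' {τ | τ 0 = a ∧ τ 1 = c}) γ := by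
    obtain ⟨⟨τ, ⟨h0, h1⟩, e⟩, hle⟩ := h
    refine ⟨⟨τ, ⟨h0, h1⟩, by simp only [h0, h1, ← hr, e, hmr]⟩, ?_⟩
    rintro _ ⟨τ', ⟨h0', h1'⟩, rfl⟩
    simp only [h0', h1', ← hr]
    exact (mul_le_mul_left (hle ⟨τ', ⟨h0', h1'⟩, rfl⟩) r).trans_eq hmr
  refine ⟨γ / γ₂, γ / γ₁, γ, hγ, fun a c hac => ?_⟩
  cases a <;> cases c
  · exact scale (mul_one γ) hmax (by simp)
  · exact scale (mul_div_cancel₀ γ hγ₁.ne') hmax₁ (by simp)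
  · exact scale (mul_div_cancel₀ γ hγ₂.ne') hmax₂ (by simp)
  · exact absurd ⟨rfl, rfl⟩ hac

section DisequalityGadget

variable {k : ℕ} {x y : Fin k → Bool} {i : Fin k → Fin 8}

/-- The extension of an assignment of the arguments in which the local variable `j + 2` carries the
literal `j`. -/
def literalAssignment (a c s : Bool) : ℕ → Bool
  | 0 => a
  | 1 => c
  | l + 2 => if h : l < 8 then literal a c s ⟨l, h⟩ else false

/-- If `mix x y` is restricted to disequality, these scopes force the local variables `4` to `9` to
be literals over the arguments. -/
def disequalityScopes (x y : Fin k → Bool) : List (Fin k → ℕ) :=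
  [mixScope x y 0 4, mixScope x y 4 5, mixScope x y 1 6, mixScope x y 6 7, mixScope x y 8 9]

/-- The scopes forcing literals, and the scope `i` of literals. -/
def literalScopes (x y : Fin k → Bool) (i : Fin k → Fin 8) : List (Fin k → ℕ) :=
  (disequalityScopes x y).insert fun l => i l + 2

/-- Pins the local variables `2` and `3` to `0` and `1`. -/
def pinUnary : ℕ → Bool → ℝ≥0 × ℝ≥0
  | 0, c => if c then (0, 0) else (0, 1)
  | 1, c => if c then (1, 0) else (0, 0)
  | _, _ => (1, 0)

/-- The gadget that applies a constraint to literals of its arguments. -/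
def literalTemplate (x y : Fin k → Bool) (i : Fin k → Fin 8) (left right : ℝ≥0) : Template k :=
  ⟨8, literalScopes x y i, pinUnary, left, right⟩

/-- The weight of the gadget of literals, up to the unary weights of its arguments and a factor
`W`. -/
def literalWeight (h : (Fin k → Bool) → ℝ≥0) (x y : Fin k → Bool) (i : Fin k → Fin 8)
    (τ : ℕ → Bool) : ℝ≥0 :=
  if τ 2 = false ∧ τ 3 = true then
    ((literalScopes x y i).map fun s => h fun j => τ (s j)).prod else 0

theorem literalTemplate_val (h : (Fin k → Bool) → ℝ≥0) (left right W : ℝ≥0) (τ : ℕ → Bool) :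
    (literalTemplate x y i left right).val h true W τ =
      literalWeight h x y i τ *
        ((if τ 0 = true then left else 1) * (if τ 1 = true then right else 1)) * W := by
  have range_eight : List.range 8 = [0, 1, 2, 3, 4, 5, 6, 7] := rfl
  simp only [literalTemplate, literalWeight, Template.val, range_eight, List.map_cons,
    List.map_nil, List.prod_cons, List.prod_nil, pinUnary]
  by_cases h2 : τ 2 = false
  · by_cases h3 : τ 3 = true
    · simp [h2, h3]
      split_ifs <;> ring
    · simp [h3]
  · simp [h2]

theorem forall_mem_literalScopes {P : (Fin k → ℕ) → Prop} :
    (∀ s ∈ literalScopes x y i, P s) ↔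
      P (fun l => i l + 2) ∧ ∀ s ∈ disequalityScopes x y, P s := by
  simp [literalScopes]

theorem literalScopes_lt : ∀ s ∈ literalScopes x y i, ∀ j, s j < 10 := by
  simp only [forall_mem_literalScopes, disequalityScopes, List.forall_mem_cons]
  refine ⟨fun j => by omega, ?_, ?_, ?_, ?_, ?_, by simp⟩ <;>
    exact mixScope_lt x y (by decide) (by decide) (by decide)

theorem literalScopes_fresh (hxy : IncompRel (· ≤ ·) x y) :
    ∀ s ∈ literalScopes x y i, ∃ j, 2 ≤ s j := by
  obtain ⟨l, -⟩ := exists_true_false_of_not_le hxy.1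
  simp only [forall_mem_literalScopes, disequalityScopes, List.forall_mem_cons]
  refine ⟨⟨l, by omega⟩, ?_, ?_, ?_, ?_, ?_, by simp⟩ <;>
    exact exists_two_le_mixScope hxy (by decide)

theorem literalScopes_nodup (hxy : IncompRel (· ≤ ·) x y) :
    ((literalScopes x y i).map fun s j => if s j = 1 then 0 else s j).Nodup := by
  have nodup : ((disequalityScopes x y).map fun s j => if s j = 1 then 0 else s j).Nodup := by
    simp [disequalityScopes, identify_mixScope, mixScope_inj hxy]
  by_cases hi : (fun l => (i l : ℕ) + 2) ∈ disequalityScopes x y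
  · rwa [literalScopes, List.insert_of_mem hi]
  rw [literalScopes, List.insert_of_not_mem hi, List.map_cons, List.nodup_cons]
  refine ⟨fun hmem => hi ?_, nodup⟩
  obtain ⟨s, hs, e⟩ := List.mem_map.1 hmem
  have s_eq : s = fun l => (i l : ℕ) + 2 := funext fun l => by
    have e_l : (if s l = 1 then 0 else s l) = if (i l : ℕ) + 2 = 1 then 0 else (i l : ℕ) + 2 :=
      congrFun e l
    split_ifs at e_l <;> omega
  rwa [← s_eq]

theorem disequalityScopes_ne_zero_iff {h : (Fin k → Bool) → ℝ≥0} {τ : ℕ → Bool}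
    (hneq : ∀ a c, h (mix x y a c) ≠ 0 ↔ c = !a) (h2 : τ 2 = false) (h3 : τ 3 = true) :
    (∀ s ∈ disequalityScopes x y, h (fun j => τ (s j)) ≠ 0) ↔
      τ 4 = (!τ 0) ∧ τ 5 = (!τ 4) ∧ τ 6 = (!τ 1) ∧ τ 7 = (!τ 6) ∧ τ 9 = !τ 8 := by
  simp only [disequalityScopes, List.forall_mem_cons, List.not_mem_nil, false_imp_iff,
    implies_true, and_true, comp_mixScope x y h2 h3, hneq]

theorem forall_eq_literal_iff {τ : ℕ → Bool} :
    (∀ j : Fin 8, τ (j + 2) = literal (τ 0) (τ 1) (τ 8) j) ↔ (τ 2 = false ∧ τ 3 = true) ∧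
      τ 4 = (!τ 0) ∧ τ 5 = (!τ 4) ∧ τ 6 = (!τ 1) ∧ τ 7 = (!τ 6) ∧ τ 9 = !τ 8 := by
  constructor
  · intro h
    have h2 : τ 2 = false := h 0
    have h3 : τ 3 = true := h 1
    have h4 : τ 4 = !τ 0 := h 2
    have h5 : τ 5 = τ 0 := h 3
    have h6 : τ 6 = !τ 1 := h 4
    have h7 : τ 7 = τ 1 := h 5
    have h9 : τ 9 = !τ 8 := h 7
    simp [*]
  · rintro ⟨⟨h2, h3⟩, h4, h5, h6, h7, h9⟩ j
    fin_cases j <;> simp [literal, *]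

theorem literalWeight_ne_zero_iff {h : (Fin k → Bool) → ℝ≥0} {τ : ℕ → Bool}
    (hneq : ∀ a c, h (mix x y a c) ≠ 0 ↔ c = !a) :
    literalWeight h x y i τ ≠ 0 ↔ (∀ j : Fin 8, τ (j + 2) = literal (τ 0) (τ 1) (τ 8) j) ∧
      h (fun l => literal (τ 0) (τ 1) (τ 8) (i l)) ≠ 0 := by
  have literalWeight_ne_zero : literalWeight h x y i τ ≠ 0 ↔ (τ 2 = false ∧ τ 3 = true) ∧
      h (fun l => τ (i l + 2)) ≠ 0 ∧ ∀ s ∈ disequalityScopes x y, h (fun l => τ (s l)) ≠ 0 := by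
    rw [← forall_mem_literalScopes (P := fun s => h (fun l => τ (s l)) ≠ 0)]
    simp [literalWeight, List.prod_eq_zero_iff, and_assoc]
  rw [literalWeight_ne_zero, forall_eq_literal_iff]
  constructor
  · rintro ⟨h23, hi, hs⟩
    have hτ := (disequalityScopes_ne_zero_iff hneq h23.1 h23.2).1 hs
    refine ⟨⟨h23, hτ⟩, ?_⟩
    simpa only [forall_eq_literal_iff.2 ⟨h23, hτ⟩] using hi
  · rintro ⟨⟨h23, hτ⟩, hi⟩
    refine ⟨h23, ?_, (disequalityScopes_ne_zero_iff hneq h23.1 h23.2).2 hτ⟩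
    simpa only [forall_eq_literal_iff.2 ⟨h23, hτ⟩] using hi

theorem exists_literalWeight_ne_zero_iff {h : (Fin k → Bool) → ℝ≥0}
    (hneq : ∀ a c, h (mix x y a c) ≠ 0 ↔ c = !a) (a c : Bool) :
    (∃ τ : ℕ → Bool, τ 0 = a ∧ τ 1 = c ∧ literalWeight h x y i τ ≠ 0) ↔
      ∃ s, h (fun j => literal a c s (i j)) ≠ 0 := by
  simp only [literalWeight_ne_zero_iff hneq]
  constructor
  · rintro ⟨τ, rfl, rfl, -, hτ⟩
    exact ⟨τ 8, hτ⟩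
  · rintro ⟨s, hs⟩
    exact ⟨literalAssignment a c s, rfl, rfl, fun j => dif_pos j.2, hs⟩

theorem dependsOn_literalWeight (h : (Fin k → Bool) → ℝ≥0) :
    DependsOn (literalWeight h x y i) (Set.Iio 10) := by
  intro τ τ' e
  have e' (l : ℕ) (hl : l < 10) : τ l = τ' l := e l hl
  have map_eq : (literalScopes x y i).map (fun s => h fun j => τ (s j)) =
      (literalScopes x y i).map fun s => h fun j => τ' (s j) :=
    List.map_congr_left fun s hs => congrArg h (funext fun j => e' _ (literalScopes_lt s hs j))
  simp only [literalWeight, map_eq, e' 2 (by decide), e' 3 (by decide)]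

theorem exists_gadget_of_disequality {f : Constraint} {x y : Fin f.arity → Bool}
    (hxy : IncompRel (· ≤ ·) x y) (hneq : ∀ a c, f.val (mix x y a c) ≠ 0 ↔ c = !a)
    (haff : ¬ f.HasAffineSupport) : Nonempty (Gadget f true) := by
  obtain ⟨u, hu, v, hv, w, hw, huvw⟩ := Constraint.exists_xor_notMem_support haff
  obtain ⟨i, hi⟩ := exists_literal_scope hu hv hw huvw
  have allowed_iff (a c : Bool) :
      (∃ τ : ℕ → Bool, τ 0 = a ∧ τ 1 = c ∧ literalWeight f.val x y i τ ≠ 0) ↔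
        ¬ (a = true ∧ c = true) :=
    (exists_literalWeight_ne_zero_iff hneq a c).trans (hi a c)
  obtain ⟨left, right, γ, hγ, hmax⟩ := exists_argument_weights
    (finite_range_of_dependsOn (dependsOn_literalWeight (x := x) (y := y) (i := i) f.val))
    fun a c => (allowed_iff a c).2
  refine ⟨{
    toTemplate := literalTemplate x y i left right
    κ := γ
    D := 1
    two_le := by simp [literalTemplate]
    arity_ne := arity_ne_one_of_incompRel hxy
    scope_lt := literalScopes_lt
    fresh := literalScopes_fresh hxy
    nodup := literalScopes_nodup hxy
    κ_pos := hγ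
    one_le_D := le_rfl
    val_le := fun W _ τ hτ => ?_
    exists_val_eq := fun W _ a c hac => ?_
    val_le_of_forbidden := fun W _ τ h0 h1 => ?_ }⟩
  · rw [literalTemplate_val]
    exact mul_le_mul_left ((hmax _ _ hτ).2 ⟨τ, ⟨rfl, rfl⟩, rfl⟩) W
  · obtain ⟨τ, ⟨h0, h1⟩, hτ⟩ := (hmax a c hac).1
    exact ⟨τ, h0, h1, by rw [literalTemplate_val]; exact congrArg (· * W) hτ⟩
  · have literalWeight_eq_zero : literalWeight f.val x y i τ = 0 := by
      by_contra hne
      exact (allowed_iff true true).1 ⟨τ, h0, h1, hne⟩ ⟨rfl, rfl⟩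
    simp [literalTemplate_val, literalWeight_eq_zero]

end DisequalityGadget

theorem exists_gadget {f : Constraint} (hAff : ¬ f.HasAffineSupport) (hImp : ¬ f.HasImpSupport) :
    ∃ b, Nonempty (Gadget f b) := by
  obtain ⟨x, hx, y, hy, hnot⟩ := Constraint.exists_inf_or_sup_notMem_support hAff hImp
  have hxy : IncompRel (· ≤ ·) x y := by
    constructor <;> intro hle <;> simp [hle, hx, hy] at hnot
  have h01 : f.val (mix x y false true) ≠ 0 := by rwa [mix_false_true]
  have h10 : f.val (mix x y true false) ≠ 0 := by rwa [mix_true_false]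
  rw [← mix_false_false, ← mix_true_true] at hnot
  by_cases h00 : f.val (mix x y false false) = 0 <;> by_cases h11 : f.val (mix x y true true) = 0
  · refine ⟨true, exists_gadget_of_disequality hxy (fun a c => ?_) hAff⟩
    cases a <;> cases c <;> simp [h00, h01, h10, h11]
  · exact ⟨false, exists_gadget_of_forbidden_pair hxy h00 h11 h01 h10⟩
  · exact ⟨true, exists_gadget_of_forbidden_pair hxy h11 h00 h10 h01⟩
  · exact absurd hnot (by simp [Constraint.support, h00, h11])

/-! ### Values of instances -/

/-- An application of a constraint to variables from an unbounded supply `x_0, x_1, …`. -/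
structure RawApp where
  con : Constraint
  scope : Fin con.arity → ℕ

namespace RawApp

/-- The encoding of an application as a string of reals, see `Application.enc`. -/
def enc (e : RawApp) : List ℝ :=
  (e.con.arity : ℝ) :: (table e.con.arity e.con.val ++ List.ofFn fun j => (e.scope j : ℝ))

/-- The value of an application under an assignment of all variables. -/
def eval (σ : ℕ → Bool) (e : RawApp) : ℝ≥0 := e.con.val fun j => σ (e.scope j)

/-- The list of the indices of the variables of an application. -/
def vars (e : RawApp) : List ℕ := List.ofFn e.scope

theorem mem_vars {e : RawApp} {u : ℕ} : u ∈ e.vars ↔ ∃ j, e.scope j = u := List.mem_ofFn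

theorem scope_mem_vars (e : RawApp) (j : Fin e.con.arity) : e.scope j ∈ e.vars :=
  mem_vars.2 ⟨j, rfl⟩

theorem eval_congr {e : RawApp} {σ σ' : ℕ → Bool} (h : ∀ u ∈ e.vars, σ u = σ' u) :
    e.eval σ = e.eval σ' :=
  congrArg e.con.val (funext fun j => h _ (e.scope_mem_vars j))

end RawApp

/-- The product of the values of the applications in a list. -/
def prodVal (L : List RawApp) (σ : ℕ → Bool) : ℝ≥0 := (L.map (RawApp.eval σ)).prod

theorem prodVal_nil (σ : ℕ → Bool) : prodVal [] σ = 1 := rfl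

theorem prodVal_cons (e : RawApp) (L : List RawApp) (σ : ℕ → Bool) :
    prodVal (e :: L) σ = e.eval σ * prodVal L σ := by
  simp [prodVal]

theorem prodVal_append (L L' : List RawApp) (σ : ℕ → Bool) :
    prodVal (L ++ L') σ = prodVal L σ * prodVal L' σ := by
  simp [prodVal]

theorem prodVal_congr {L : List RawApp} {σ σ' : ℕ → Bool}
    (h : ∀ e ∈ L, ∀ u ∈ e.vars, σ u = σ' u) : prodVal L σ = prodVal L σ' :=
  congrArg List.prod (List.map_congr_left fun e he => RawApp.eval_congr (h e he))

section Application

variable {n : ℕ}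

/-- An application of a constraint to variables among `x_0, …, x_{n-1}` as an application to
variables from an unbounded supply. -/
def Application.raw (a : Application n) : RawApp := ⟨a.con, fun j => a.scope j⟩

theorem Application.raw_injective : Function.Injective (Application.raw (n := n)) := by
  rintro ⟨c, s⟩ ⟨c', s'⟩ h
  simp only [Application.raw, RawApp.mk.injEq] at h
  obtain ⟨rfl, h⟩ := h
  congr 1
  funext j
  exact Fin.ext (congrFun (eq_of_heq h) j)

theorem Application.lt_of_mem_vars (a : Application n) {u : ℕ} (hu : u ∈ a.raw.vars) : u < n := by
  obtain ⟨j, rfl⟩ := RawApp.mem_vars.1 hu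
  exact (a.scope j).2

theorem prodVal_map_raw_congr (H : List (Application n)) {σ σ' : ℕ → Bool}
    (h : ∀ u < n, σ u = σ' u) :
    prodVal (H.map Application.raw) σ = prodVal (H.map Application.raw) σ' := by
  refine prodVal_congr fun e he u hu => ?_
  obtain ⟨a, -, rfl⟩ := List.mem_map.1 he
  exact h u (a.lt_of_mem_vars hu)

end Application

/-- The assignment of all variables given by a bit string. -/
def bits (y : List Bool) (i : ℕ) : Bool := y.getD i false

theorem bits_ofFn {n u : ℕ} (σ : ℕ → Bool) (hu : u < n) :
    bits (List.ofFn fun i : Fin n => σ i) u = σ u := by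
  simp [bits, List.getD, hu]

theorem bits_take {n u : ℕ} (y : List Bool) (hu : u < n) : bits (y.take n) u = bits y u := by
  simp [bits, List.getD, hu]

section Instances

variable {F : Set Constraint}

theorem CSPInst.value_eq_prodVal (x : CSPInst F) (y : List Bool) :
    x.value y = prodVal (x.H.map Application.raw) (bits y) := by
  rw [prodVal, List.map_map]
  rfl

theorem CSPInst.enc_eq (x : CSPInst F) :
    x.enc = List.replicate x.n 1 ++ 0 :: (x.H.map Application.raw).flatMap RawApp.enc := by
  rw [List.flatMap_map]
  rfl

theorem exists_inst_of_rawApps (F : Set Constraint) {n : ℕ} {L : List RawApp} (hL : L.Nodup)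
    (vars_lt : ∀ e ∈ L, ∀ u ∈ e.vars, u < n) (con_mem : ∀ e ∈ L, e.con ∈ F) :
    ∃ w : CSPInst F, w.n = n ∧ w.H.map Application.raw = L := by
  have scope_lt : ∀ e ∈ L, ∀ j, e.scope j < n := fun e he j => vars_lt e he _ (e.scope_mem_vars j)
  let bounded (e : RawApp) (he : ∀ j, e.scope j < n) : Application n :=
    ⟨e.con, fun j => ⟨e.scope j, he j⟩⟩
  have raw_bounded (e he) : (bounded e he).raw = e := rfl
  refine ⟨⟨n, L.pmap bounded scope_lt, ?_, ?_⟩, rfl, ?_⟩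
  · refine hL.pmap fun e he e' he' h => ?_
    rw [← raw_bounded e he, h, raw_bounded]
  · intro a ha
    obtain ⟨e, he, rfl⟩ := List.mem_pmap.1 ha
    exact con_mem e he
  · rw [List.map_pmap]
    exact (List.pmap_eq_map (f := id) scope_lt).trans (List.map_id L)

theorem exists_isOptimal (x : CSPInst F) : ∃ z, (maxProdCSP F).IsOptimal x z :=
  Set.exists_max_image {y : List Bool | y.length = x.n} ((maxProdCSP F).measure x)
    (List.finite_length_eq Bool x.n) ⟨List.replicate x.n false, by simp⟩

theorem measure_eq_prodVal (x : CSPInst F) {y : List Bool} (hy : y.length = x.n) :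
    (maxProdCSP F).measure x y = prodVal (x.H.map Application.raw) (bits y) :=
  (if_pos hy).trans (x.value_eq_prodVal y)

theorem isOptimal_iff_forall_le (x : CSPInst F) (z : List Bool) :
    (maxProdCSP F).IsOptimal x z ↔ z.length = x.n ∧
      ∀ σ, prodVal (x.H.map Application.raw) σ ≤ prodVal (x.H.map Application.raw) (bits z) := by
  refine and_congr_right fun hz => ?_
  rw [measure_eq_prodVal x hz]
  refine ⟨fun h σ => ?_, fun h y hy => (measure_eq_prodVal x hy).trans_le (h _)⟩
  have length_eq : (List.ofFn fun i : Fin x.n => σ i).length = x.n := by simp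
  refine Eq.trans_le ?_ (h _ length_eq)
  rw [measure_eq_prodVal x length_eq]
  exact prodVal_map_raw_congr _ fun u hu => (bits_ofFn σ hu).symm

theorem isApproxSol_iff_forall_le (x : CSPInst F) {r : ℝ≥0} (hr : 1 ≤ r) (y : List Bool) :
    (maxProdCSP F).IsApproxSol x r y ↔ y.length = x.n ∧
      ∀ σ, prodVal (x.H.map Application.raw) σ ≤
        prodVal (x.H.map Application.raw) (bits y) * r := by
  refine and_congr_right fun hy => ?_
  have hr0 : 0 < r := one_pos.trans_le hr
  constructor
  · rintro ⟨z, hz, hzero, hratio⟩ σ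
    obtain ⟨hzl, hmax⟩ := (isOptimal_iff_forall_le x z).1 hz
    rw [measure_eq_prodVal x hzl, measure_eq_prodVal x hy] at hzero hratio
    refine (hmax σ).trans ?_
    rcases eq_or_ne (prodVal (x.H.map Application.raw) (bits z)) 0 with h0 | h0
    · simp [h0]
    · have hle := (hratio h0).1
      rw [div_le_div_iff₀ (by exact_mod_cast hr0) (by exact_mod_cast pos_iff_ne_zero.2 h0),
        one_mul] at hle
      exact_mod_cast hle
  · intro h
    obtain ⟨z, hz⟩ := exists_isOptimal x
    obtain ⟨hzl, hmax⟩ := (isOptimal_iff_forall_le x z).1 hz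
    refine ⟨z, hz, ?_⟩
    rw [measure_eq_prodVal x hzl, measure_eq_prodVal x hy]
    refine ⟨fun h0 => le_zero_iff.1 (h0 ▸ hmax (bits y)), fun h0 => ?_⟩
    have hz0 := pos_iff_ne_zero.2 h0
    rw [← NNReal.coe_div, ← NNReal.coe_one, ← NNReal.coe_div, NNReal.coe_le_coe, NNReal.coe_le_coe,
      div_le_div_iff₀ hr0 hz0, one_mul]
    exact ⟨h _, ((div_le_one hz0).2 (hmax _)).trans hr⟩

end Instances

/-! ### Replacing constraints by gadgets -/

/-- The unary constraint `(c, d)`. -/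
def unary (c d : ℝ≥0) : Constraint := ⟨1, fun x => if x 0 then d else c⟩

theorem unary_val (c : Bool → ℝ≥0) (x : Fin 1 → Bool) :
    (unary (c false) (c true)).val x = c (x 0) := by
  change (if x 0 then _ else _) = _
  cases x 0 <;> rfl

/-- The unary constraint with the value `c * d` at `b` and `d` at `!b`. -/
def scaled (b : Bool) (c d : ℝ≥0) : Constraint :=
  unary (if b then d else c * d) (if b then c * d else d)

theorem scaled_val (b : Bool) (c d : ℝ≥0) (x : Fin (scaled b c d).arity → Bool) :
    (scaled b c d).val x = (if x (0 : Fin 1) = b then c else 1) * d := by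
  change (if x (0 : Fin 1) then _ else _) = _
  cases b <;> cases x (0 : Fin 1) <;> simp

/-- The variable that a local variable of a gadget stands for, if the arguments are `x_i` and `x_j`
and the auxiliary variables are `x_v, x_{v+1}, …`. -/
def loc (i j v : ℕ) : ℕ → ℕ
  | 0 => i
  | 1 => j
  | l + 2 => v + l

theorem loc_add_two (i j v l : ℕ) : loc i j v (l + 2) = v + l := rfl

theorem loc_eq_or {i j v l m : ℕ} (hl : l < m + 2) :
    loc i j v l = i ∨ loc i j v l = j ∨ (v ≤ loc i j v l ∧ loc i j v l < v + m) := by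
  rcases l with _ | _ | l
  · exact .inl rfl
  · exact .inr (.inl rfl)
  · exact .inr (.inr ⟨Nat.le_add_right v l, by rw [loc_add_two]; omega⟩)

namespace Gadget

variable {f : Constraint} {b : Bool} (G : Gadget f b)

/-- The applications of a copy of a gadget that involve an auxiliary variable. -/
def innerApps (W : ℝ≥0) (v i j : ℕ) : List RawApp :=
  (G.scopes.map fun s => ⟨f, fun l => loc i j v (s l)⟩) ++
  (List.range G.aux).map fun l =>
    ⟨unary ((G.weight l false).1 + (G.weight l false).2 * W)
      ((G.weight l true).1 + (G.weight l true).2 * W), fun _ => v + l⟩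

/-- The applications that put the unary weights `left` and `right` on the arguments of a copy of a
gadget. The factors `W + v` and `W + v + 1` only serve to make the applications of different copies
distinct. -/
def outerApps (W : ℝ≥0) (v i j : ℕ) : List RawApp :=
  [⟨scaled b G.left (W + v), fun _ => i⟩, ⟨scaled b G.right (W + v + 1), fun _ => j⟩]

/-- The copy of a gadget with the arguments `x_i` and `x_j` and auxiliary variables
`x_v, x_{v+1}, …`. -/
def emit (W : ℝ≥0) (v i j : ℕ) : List RawApp := G.innerApps W v i j ++ G.outerApps W v i j

theorem prodVal_innerApps (W : ℝ≥0) (v i j : ℕ) (σ : ℕ → Bool) :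
    prodVal (G.innerApps W v i j) σ =
      (G.scopes.map fun s => f.val fun l => σ (loc i j v (s l))).prod *
      ((List.range G.aux).map fun l =>
        (G.weight l (σ (v + l))).1 + (G.weight l (σ (v + l))).2 * W).prod := by
  rw [innerApps, prodVal_append, prodVal, prodVal, List.map_map, List.map_map]
  refine congrArg (_ * ·) (congrArg List.prod <| List.map_congr_left fun l _ => ?_)
  exact unary_val (fun c => (G.weight l c).1 + (G.weight l c).2 * W) _

theorem prodVal_outerApps (W : ℝ≥0) (v i j : ℕ) (σ : ℕ → Bool) :
    prodVal (G.outerApps W v i j) σ =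
      ((if σ i = b then G.left else 1) * (if σ j = b then G.right else 1)) *
        ((W + v) * (W + v + 1)) := by
  rw [mul_mul_mul_comm]
  simp [outerApps, prodVal, RawApp.eval, scaled_val]

theorem prodVal_emit (W : ℝ≥0) (v i j : ℕ) (σ : ℕ → Bool) :
    prodVal (G.emit W v i j) σ =
      G.val f.val b W (fun l => σ (loc i j v l)) * ((W + v) * (W + v + 1)) := by
  rw [emit, prodVal_append, prodVal_innerApps, prodVal_outerApps, ← mul_assoc]
  rfl

theorem exists_le_of_mem_innerApps {W : ℝ≥0} {v i j : ℕ} {e : RawApp}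
    (he : e ∈ G.innerApps W v i j) : ∃ u ∈ e.vars, v ≤ u := by
  rcases List.mem_append.1 he with he | he
  · obtain ⟨s, hs, rfl⟩ := List.mem_map.1 he
    obtain ⟨c, hc⟩ := G.fresh s hs
    refine ⟨loc i j v (s c), RawApp.mem_vars.2 ⟨c, rfl⟩, ?_⟩
    obtain ⟨l, hl⟩ := Nat.exists_eq_add_of_le' hc
    simp [hl, loc]
  · obtain ⟨l, -, rfl⟩ := List.mem_map.1 he
    exact ⟨v + l, RawApp.mem_vars.2 ⟨(0 : Fin 1), rfl⟩, by omega⟩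

theorem vars_of_mem_outerApps {W : ℝ≥0} {v i j : ℕ} {e : RawApp}
    (he : e ∈ G.outerApps W v i j) : e.vars = [i] ∨ e.vars = [j] := by
  simp only [outerApps, List.mem_cons, List.not_mem_nil, or_false] at he
  rcases he with rfl | rfl
  exacts [.inl rfl, .inr rfl]

theorem val_of_mem_outerApps {W : ℝ≥0} {v i j : ℕ} {e : RawApp} (he : e ∈ G.outerApps W v i j) :
    ∃ c : ℕ, v ≤ c ∧ c < v + G.aux ∧ e.con.val (fun _ => !b) = W + c := by
  have two_le := G.two_le
  simp only [outerApps, List.mem_cons, List.not_mem_nil, or_false] at he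
  rcases he with rfl | rfl
  · exact ⟨v, le_rfl, by omega, by simp [scaled_val]⟩
  · exact ⟨v + 1, by omega, by omega, by simp [scaled_val, add_assoc]⟩

theorem vars_of_mem_emit {W : ℝ≥0} {v i j : ℕ} {e : RawApp} (he : e ∈ G.emit W v i j) {u : ℕ}
    (hu : u ∈ e.vars) : u = i ∨ u = j ∨ (v ≤ u ∧ u < v + G.aux) := by
  rcases List.mem_append.1 he with he | he
  · rcases List.mem_append.1 he with he | he
    · obtain ⟨s, hs, rfl⟩ := List.mem_map.1 he
      obtain ⟨c, rfl⟩ := RawApp.mem_vars.1 hu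
      exact loc_eq_or (G.scope_lt s hs c)
    · obtain ⟨l, hl, rfl⟩ := List.mem_map.1 he
      obtain ⟨-, rfl⟩ := RawApp.mem_vars.1 hu
      have l_lt := List.mem_range.1 hl
      exact .inr (.inr ⟨by simp, by simpa using l_lt⟩)
  · rcases G.vars_of_mem_outerApps he with h | h <;> simp_all

theorem nodup_innerApps (W : ℝ≥0) {v i j : ℕ} (hi : i < v) (hj : j < v) :
    (G.innerApps W v i j).Nodup := by
  refine List.nodup_append.2 ⟨?_, ?_, ?_⟩
  · refine List.Nodup.of_map (fun e : RawApp => fun c : Fin f.arity =>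
      if e.vars.getD c 0 < v then 0 else e.vars.getD c 0 - v + 2) ?_
    rw [List.map_map]
    convert G.nodup using 2
    funext s c
    have getD_vars : (RawApp.vars ⟨f, fun l => loc i j v (s l)⟩).getD c 0 = loc i j v (s c) := by
      simp [RawApp.vars, List.getD]
    simp only [Function.comp, getD_vars]
    rcases s c with _ | _ | l <;> simp [loc, hi, hj]
  · refine List.Nodup.of_map RawApp.vars ?_
    rw [List.map_map]
    refine List.Nodup.map (fun l l' (h : [v + l] = [v + l']) => ?_) List.nodup_range
    simpa using h
  · rintro e he e' he' rfl
    obtain ⟨s, -, rfl⟩ := List.mem_map.1 he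
    obtain ⟨l, -, h⟩ := List.mem_map.1 he'
    exact G.arity_ne (congrArg (fun e : RawApp => e.con.arity) h).symm

theorem nodup_outerApps (W : ℝ≥0) (v i j : ℕ) : (G.outerApps W v i j).Nodup := by
  simp only [outerApps, List.nodup_cons, List.mem_singleton, List.not_mem_nil, not_false_eq_true,
    List.nodup_nil, and_true]
  intro h
  have val_eq := congrArg (fun e : RawApp => e.con.val fun _ => !b) h
  simp [scaled_val] at val_eq

theorem nodup_emit (W : ℝ≥0) {v i j : ℕ} (hi : i < v) (hj : j < v) :
    (G.emit W v i j).Nodup := by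
  refine List.nodup_append.2 ⟨G.nodup_innerApps W hi hj, G.nodup_outerApps W v i j, ?_⟩
  rintro e he e' he' rfl
  obtain ⟨u, hu, hle⟩ := G.exists_le_of_mem_innerApps he
  rcases G.vars_of_mem_outerApps he' with h | h <;>
    · rw [h, List.mem_singleton] at hu
      omega

theorem exists_prodVal_emit_eq {W : ℝ≥0} (hW : G.D ≤ W) {v i j : ℕ} (hi : i < v) (hj : j < v)
    (σ : ℕ → Bool) (hσ : ¬ (σ i = b ∧ σ j = b)) :
    ∃ σ₁ : ℕ → Bool, (∀ u < v, σ₁ u = σ u) ∧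
      ∀ σ', (∀ u < v + G.aux, σ' u = σ₁ u) →
        prodVal (G.emit W v i j) σ' = G.κ * W * ((W + v) * (W + v + 1)) := by
  obtain ⟨τ, hτ0, hτ1, hτ⟩ := G.exists_val_eq W hW _ _ hσ
  let σ₁ : ℕ → Bool := fun u => if v ≤ u then τ (u - v + 2) else σ u
  have σ₁_eq : ∀ u < v, σ₁ u = σ u := fun u hu => by simp [σ₁, not_le.2 hu]
  have σ₁_loc : (fun l => σ₁ (loc i j v l)) = τ := by
    funext l
    rcases l with _ | _ | l
    · simp [loc, σ₁_eq _ hi, hτ0]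
    · simp [loc, σ₁_eq _ hj, hτ1]
    · simp [loc, σ₁]
  refine ⟨σ₁, σ₁_eq, fun σ' hσ' => ?_⟩
  have emit_congr : prodVal (G.emit W v i j) σ' = prodVal (G.emit W v i j) σ₁ :=
    prodVal_congr fun e he u hu => hσ' u <| by
      have u_cases := G.vars_of_mem_emit he hu
      omega
  rw [emit_congr, prodVal_emit, σ₁_loc, hτ]

end Gadget

/-- The `c`-th variable of an application. -/
def Application.arg {n : ℕ} (a : Application n) (c : ℕ) : ℕ := a.raw.vars.getD c 0

section ForbidApplications

variable {n : ℕ} {b : Bool}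

theorem eval_raw_forbid {a : Application n} (ha : a.con = forbid b) (σ : ℕ → Bool) :
    a.raw.eval σ = if σ (a.arg 0) = b ∧ σ (a.arg 1) = b then 0 else 1 := by
  obtain ⟨c, s⟩ := a
  subst ha
  rfl

theorem arg_lt_of_forbid {a : Application n} (ha : a.con = forbid b) :
    a.arg 0 < n ∧ a.arg 1 < n := by
  obtain ⟨c, s⟩ := a
  subst ha
  exact ⟨(s (0 : Fin 2)).2, (s (1 : Fin 2)).2⟩

end ForbidApplications

namespace Gadget

variable {f : Constraint} {b : Bool} (G : Gadget f b) {n : ℕ}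

open Classical in
/-- Replaces every application of `forbid b` by a copy of the gadget; `x_v` is the first fresh
variable. -/
def trans (W : ℝ≥0) : ℕ → List (Application n) → List RawApp
  | _, [] => []
  | v, a :: H =>
    if a.con = forbid b then trans W (v + G.aux) H ++ G.emit W v (a.arg 0) (a.arg 1)
    else trans W v H ++ [a.raw]

open Classical in
/-- The number of variables after the translation. -/
def vEnd : ℕ → List (Application n) → ℕ
  | v, [] => v
  | v, a :: H => if a.con = forbid b then vEnd (v + G.aux) H else vEnd v H

open Classical in
/-- The factor by which the translation scales the values. -/
def factor (W : ℝ≥0) : ℕ → List (Application n) → ℝ≥0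
  | _, [] => 1
  | v, a :: H =>
    if a.con = forbid b then factor W (v + G.aux) H * (G.κ * W * ((W + v) * (W + v + 1)))
    else factor W v H

theorem trans_cons_of_forbid (W : ℝ≥0) (v : ℕ) {a : Application n} (ha : a.con = forbid b)
    (H : List (Application n)) :
    G.trans W v (a :: H) = G.trans W (v + G.aux) H ++ G.emit W v (a.arg 0) (a.arg 1) :=
  if_pos ha

theorem trans_cons_of_ne (W : ℝ≥0) (v : ℕ) {a : Application n} (ha : a.con ≠ forbid b)
    (H : List (Application n)) : G.trans W v (a :: H) = G.trans W v H ++ [a.raw] :=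
  if_neg ha

theorem vEnd_cons_of_forbid (v : ℕ) {a : Application n} (ha : a.con = forbid b)
    (H : List (Application n)) : G.vEnd v (a :: H) = G.vEnd (v + G.aux) H :=
  if_pos ha

theorem vEnd_cons_of_ne (v : ℕ) {a : Application n} (ha : a.con ≠ forbid b)
    (H : List (Application n)) : G.vEnd v (a :: H) = G.vEnd v H :=
  if_neg ha

theorem factor_cons_of_forbid (W : ℝ≥0) (v : ℕ) {a : Application n} (ha : a.con = forbid b)
    (H : List (Application n)) :
    G.factor W v (a :: H) = G.factor W (v + G.aux) H * (G.κ * W * ((W + v) * (W + v + 1))) :=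
  if_pos ha

theorem factor_cons_of_ne (W : ℝ≥0) (v : ℕ) {a : Application n} (ha : a.con ≠ forbid b)
    (H : List (Application n)) : G.factor W v (a :: H) = G.factor W v H :=
  if_neg ha

theorem le_vEnd (v : ℕ) (H : List (Application n)) : v ≤ G.vEnd v H := by
  induction H generalizing v with
  | nil => exact le_rfl
  | cons a H ih =>
    by_cases ha : a.con = forbid b
    · rw [G.vEnd_cons_of_forbid v ha]
      exact (Nat.le_add_right _ _).trans (ih _)
    · rw [G.vEnd_cons_of_ne v ha]
      exact ih v

theorem factor_pos {W : ℝ≥0} (hW : 0 < W) (v : ℕ) (H : List (Application n)) :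
    0 < G.factor W v H := by
  induction H generalizing v with
  | nil => exact one_pos
  | cons a H ih =>
    by_cases ha : a.con = forbid b
    · rw [G.factor_cons_of_forbid W v ha]
      have κ_pos := G.κ_pos
      have tail_pos := ih (v + G.aux)
      positivity
    · rw [G.factor_cons_of_ne W v ha]
      exact ih v

theorem mem_trans {W : ℝ≥0} {v : ℕ} {H : List (Application n)} {e : RawApp}
    (he : e ∈ G.trans W v H) : (∃ a ∈ H, a.con ≠ forbid b ∧ a.raw = e) ∨
      ∃ a ∈ H, a.con = forbid b ∧ ∃ v', v ≤ v' ∧ v' + G.aux ≤ G.vEnd v H ∧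
        e ∈ G.emit W v' (a.arg 0) (a.arg 1) := by
  induction H generalizing v with
  | nil => simp [trans] at he
  | cons a H ih =>
    by_cases ha : a.con = forbid b
    · rw [G.trans_cons_of_forbid W v ha, List.mem_append] at he
      rw [G.vEnd_cons_of_forbid v ha]
      rcases he with he | he
      · rcases ih he with ⟨a', ha', h⟩ | ⟨a', ha', h, v', hle, h'⟩
        · exact .inl ⟨a', List.mem_cons_of_mem a ha', h⟩
        · exact .inr ⟨a', List.mem_cons_of_mem a ha', h, v', by omega, h'⟩
      · exact .inr ⟨a, List.mem_cons_self, ha, v, le_rfl, G.le_vEnd _ H, he⟩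
    · rw [G.trans_cons_of_ne W v ha, List.mem_append, List.mem_singleton] at he
      rw [G.vEnd_cons_of_ne v ha]
      rcases he with he | rfl
      · rcases ih he with ⟨a', ha', h⟩ | ⟨a', ha', h⟩
        · exact .inl ⟨a', List.mem_cons_of_mem a ha', h⟩
        · exact .inr ⟨a', List.mem_cons_of_mem a ha', h⟩
      · exact .inl ⟨a, List.mem_cons_self, ha, rfl⟩

theorem vars_of_mem_trans {W : ℝ≥0} {v : ℕ} {H : List (Application n)} {e : RawApp}
    (he : e ∈ G.trans W v H) {u : ℕ} (hu : u ∈ e.vars) :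
    u < n ∨ (v ≤ u ∧ u < G.vEnd v H) := by
  rcases G.mem_trans he with ⟨a, -, -, rfl⟩ | ⟨a, -, ha, v', hle, hlt, he'⟩
  · exact .inl (a.lt_of_mem_vars hu)
  · have arg_lt := arg_lt_of_forbid ha
    have u_cases := G.vars_of_mem_emit he' hu
    omega

theorem con_mem_of_mem_trans {F : Set Constraint} {W : ℝ≥0} {v : ℕ} {H : List (Application n)}
    (hH : ∀ a ∈ H, a.con ∈ {forbid b} ∪ F ∪ U) {e : RawApp} (he : e ∈ G.trans W v H) :
    e.con ∈ {f} ∪ F ∪ U := by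
  rcases G.mem_trans he with ⟨a, ha, hne, rfl⟩ | ⟨a, -, -, v', -, -, he'⟩
  · rcases hH a ha with (h | h) | h
    exacts [absurd h hne, .inl (.inr h), .inr h]
  · simp only [emit, innerApps, outerApps, List.mem_append, List.mem_map, List.mem_cons,
      List.not_mem_nil, or_false] at he'
    rcases he' with (⟨s, -, rfl⟩ | ⟨l, -, rfl⟩) | rfl | rfl
    exacts [.inl (.inl rfl), .inr rfl, .inr rfl, .inr rfl]

theorem notMem_trans_of_mem_emit {W : ℝ≥0} {v : ℕ} {H : List (Application n)}
    (hW : ∀ a ∈ H, ∀ x, a.con.val x < W) {i j : ℕ} (hn : n ≤ v) (hi : i < n) (hj : j < n)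
    {e : RawApp} (he : e ∈ G.emit W v i j) : e ∉ G.trans W (v + G.aux) H := by
  intro he'
  have not_fresh : ¬ ∃ u ∈ e.vars, v ≤ u := by
    rintro ⟨u, hu, hvu⟩
    have u_cases := G.vars_of_mem_emit he hu
    have u_cases' := G.vars_of_mem_trans he' hu
    omega
  rcases List.mem_append.1 he with he | he
  · exact not_fresh (G.exists_le_of_mem_innerApps he)
  obtain ⟨c, -, hc, val_eq⟩ := G.val_of_mem_outerApps he
  rcases G.mem_trans he' with ⟨a, ha, -, rfl⟩ | ⟨a, -, -, v', hv', -, he'⟩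
  · exact absurd (hW a ha fun _ => !b) (by rw [← not_le, not_not]; exact val_eq ▸ le_self_add)
  rcases List.mem_append.1 he' with he' | he'
  · obtain ⟨u, hu, hle⟩ := G.exists_le_of_mem_innerApps he'
    exact not_fresh ⟨u, hu, by omega⟩
  · obtain ⟨c', hc', -, val_eq'⟩ := G.val_of_mem_outerApps he'
    have c_eq : c = c' := by simpa using val_eq.symm.trans val_eq'
    omega

theorem raw_notMem_trans {W : ℝ≥0} {v : ℕ} {H : List (Application n)} {a : Application n}
    (hn : n ≤ v) (ha : a ∉ H) (hW : ∀ x, a.con.val x < W) : a.raw ∉ G.trans W v H := by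
  intro he
  rcases G.mem_trans he with ⟨a', ha', -, h⟩ | ⟨a', -, -, v', hv', -, he'⟩
  · exact ha (Application.raw_injective h ▸ ha')
  rcases List.mem_append.1 he' with he' | he'
  · obtain ⟨u, hu, hle⟩ := G.exists_le_of_mem_innerApps he'
    have u_lt := a.lt_of_mem_vars hu
    omega
  · obtain ⟨c, -, -, val_eq⟩ := G.val_of_mem_outerApps he'
    exact absurd (hW fun _ => !b) (by rw [← not_le, not_not]; exact val_eq ▸ le_self_add)

theorem nodup_trans {W : ℝ≥0} {v : ℕ} (hn : n ≤ v) {H : List (Application n)} (hH : H.Nodup)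
    (hW : ∀ a ∈ H, ∀ x, a.con.val x < W) : (G.trans W v H).Nodup := by
  induction H generalizing v with
  | nil => exact List.nodup_nil
  | cons a H ih =>
    obtain ⟨ha, hH⟩ := List.nodup_cons.1 hH
    obtain ⟨hWa, hW⟩ := List.forall_mem_cons.1 hW
    by_cases hf : a.con = forbid b
    · obtain ⟨hi, hj⟩ := arg_lt_of_forbid hf
      rw [G.trans_cons_of_forbid W v hf]
      refine List.nodup_append'.2 ⟨ih (by omega) hH hW,
        G.nodup_emit W (hi.trans_le hn) (hj.trans_le hn), ?_⟩
      exact List.disjoint_right.2 fun e he => G.notMem_trans_of_mem_emit hW hn hi hj he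
    · rw [G.trans_cons_of_ne W v hf]
      refine List.nodup_append'.2 ⟨ih hn hH hW, List.nodup_singleton _, ?_⟩
      exact List.disjoint_singleton.2 (G.raw_notMem_trans hn ha hWa)

theorem exists_prodVal_trans_eq {W : ℝ≥0} (hW : G.D ≤ W) {v : ℕ} (hn : n ≤ v)
    (H : List (Application n)) (σ : ℕ → Bool) (hσ : prodVal (H.map Application.raw) σ ≠ 0) :
    ∃ σ' : ℕ → Bool, (∀ u < v, σ' u = σ u) ∧
      prodVal (G.trans W v H) σ' = G.factor W v H * prodVal (H.map Application.raw) σ := by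
  induction H generalizing v σ with
  | nil => exact ⟨σ, fun _ _ => rfl, by simp [trans, factor, prodVal]⟩
  | cons a H ih =>
    rw [List.map_cons, prodVal_cons] at hσ ⊢
    obtain ⟨hσa, hσH⟩ := mul_ne_zero_iff.1 hσ
    by_cases ha : a.con = forbid b
    · obtain ⟨hi, hj⟩ := arg_lt_of_forbid ha
      have allowed : ¬ (σ (a.arg 0) = b ∧ σ (a.arg 1) = b) := fun h =>
        hσa (by rw [eval_raw_forbid ha, if_pos h])
      obtain ⟨σ₁, σ₁_eq, emit_eq⟩ :=
        G.exists_prodVal_emit_eq hW (hi.trans_le hn) (hj.trans_le hn) σ allowed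
      have tail_eq := prodVal_map_raw_congr H fun u hu => σ₁_eq u (hu.trans_le hn)
      obtain ⟨σ', σ'_eq, trans_eq⟩ := ih (v := v + G.aux) (by omega) σ₁ (tail_eq ▸ hσH)
      refine ⟨σ', fun u hu => by rw [σ'_eq u (by omega), σ₁_eq u hu], ?_⟩
      rw [G.trans_cons_of_forbid W v ha, G.factor_cons_of_forbid W v ha, prodVal_append, trans_eq,
        tail_eq, emit_eq σ' σ'_eq, eval_raw_forbid ha, if_neg allowed]
      ring
    · obtain ⟨σ', σ'_eq, trans_eq⟩ := ih hn σ hσH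
      have eval_eq : a.raw.eval σ' = a.raw.eval σ :=
        RawApp.eval_congr fun u hu => σ'_eq u ((a.lt_of_mem_vars hu).trans_le hn)
      refine ⟨σ', σ'_eq, ?_⟩
      rw [G.trans_cons_of_ne W v ha, G.factor_cons_of_ne W v ha, prodVal_append, trans_eq,
        prodVal_cons, prodVal_nil, eval_eq]
      ring

end Gadget

/-! ### Approximate optima of the translated instance -/

/-- The number `u` bounds the values of `h` from above, and its inverse bounds the nonzero values
from below. -/
structure Constraint.IsBoundedBy (h : Constraint) (u : ℝ≥0) : Prop where
  one_le : 1 ≤ u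
  val_le : ∀ z, h.val z ≤ u
  one_le_val_mul : ∀ z, h.val z ≠ 0 → 1 ≤ h.val z * u

section Penalty

variable {n : ℕ} {b : Bool}

open Classical in
/-- The value of an instance when a violated application of `forbid b` only costs a factor `η`
instead of making the product vanish. -/
def penVal (b : Bool) (η : ℝ≥0) (H : List (Application n)) (σ : ℕ → Bool) : ℝ≥0 :=
  (H.map fun a => if a.con = forbid b then
    (if σ (a.arg 0) = b ∧ σ (a.arg 1) = b then η else 1) else a.raw.eval σ).prod

theorem penVal_eq_or_le {η : ℝ≥0} (hη : η ≤ 1) (H : List (Application n)) (σ : ℕ → Bool)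
    {u : Application n → ℝ≥0} (hu : ∀ a ∈ H, a.con.IsBoundedBy (u a)) :
    (penVal b η H σ = prodVal (H.map Application.raw) σ ∧ penVal b η H σ ≤ (H.map u).prod) ∨
      penVal b η H σ ≤ η * (H.map u).prod := by
  induction H with
  | nil => exact .inl ⟨rfl, le_rfl⟩
  | cons a H ih =>
    obtain ⟨ha, hH⟩ := List.forall_mem_cons.1 hu
    specialize ih hH
    simp only [penVal, List.map_cons, prodVal_cons, List.prod_cons] at ih ⊢
    split_ifs with hf hv
    · refine .inr (mul_le_mul_right ?_ η)
      have le_prod := ih.elim And.right fun h => h.trans (mul_le_of_le_one_left zero_le hη)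
      exact le_prod.trans (le_mul_of_one_le_left zero_le ha.one_le)
    · rw [eval_raw_forbid hf, if_neg hv, one_mul, one_mul]
      have le_mul := le_mul_of_one_le_left (zero_le (a := (H.map u).prod)) ha.one_le
      exact ih.imp (fun h => ⟨h.1, h.2.trans le_mul⟩) fun h => h.trans (mul_le_mul_right le_mul η)
    · have eval_le : a.raw.eval σ ≤ u a := ha.val_le _
      refine ih.imp (fun h => ⟨by rw [h.1], mul_le_mul' eval_le h.2⟩) fun h => ?_
      exact (mul_le_mul' eval_le h).trans_eq (mul_left_comm _ _ _)

theorem one_le_prodVal_mul {H : List (Application n)} {σ : ℕ → Bool} {u : Application n → ℝ≥0}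
    (hu : ∀ a ∈ H, a.con.IsBoundedBy (u a)) (hσ : prodVal (H.map Application.raw) σ ≠ 0) :
    1 ≤ prodVal (H.map Application.raw) σ * (H.map u).prod := by
  induction H with
  | nil => simp [prodVal]
  | cons a H ih =>
    obtain ⟨ha, hH⟩ := List.forall_mem_cons.1 hu
    rw [List.map_cons, prodVal_cons] at hσ ⊢
    obtain ⟨hσa, hσH⟩ := mul_ne_zero_iff.1 hσ
    rw [List.map_cons, List.prod_cons, mul_mul_mul_comm]
    exact one_le_mul (ha.one_le_val_mul _ hσa) (ih hH hσH)

theorem one_le_prod_map {H : List (Application n)} {u : Application n → ℝ≥0}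
    (hu : ∀ a ∈ H, a.con.IsBoundedBy (u a)) : 1 ≤ (H.map u).prod :=
  List.one_le_prod_of_one_le (by simpa using fun a ha => (hu a ha).one_le)

/-- Violating an application of `forbid b` is too expensive for an approximate optimum. -/
theorem prodVal_le_mul_of_le_penVal_mul {η r : ℝ≥0} {H : List (Application n)}
    {u : Application n → ℝ≥0} (hu : ∀ a ∈ H, a.con.IsBoundedBy (u a)) (hr : r < 2)
    (hη : η * (H.map u).prod ^ 2 ≤ 1 / 2) {σ σ₀ : ℕ → Bool}
    (h : prodVal (H.map Application.raw) σ₀ ≤ penVal b η H σ * r) :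
    prodVal (H.map Application.raw) σ₀ ≤ prodVal (H.map Application.raw) σ * r := by
  rcases eq_or_ne (prodVal (H.map Application.raw) σ₀) 0 with h0 | h0
  · simp [h0]
  have hP := one_le_prod_map hu
  have η_le_one : η ≤ 1 := calc
    η ≤ η * (H.map u).prod ^ 2 := le_mul_of_one_le_right zero_le (one_le_pow₀ hP)
    _ ≤ 1 / 2 := hη
    _ ≤ 1 := half_le_self zero_le
  rcases penVal_eq_or_le η_le_one H σ hu with ⟨heq, -⟩ | hle
  · rwa [← heq]
  refine absurd ?_ (lt_irrefl (1 : ℝ≥0))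
  calc (1 : ℝ≥0) ≤ prodVal (H.map Application.raw) σ₀ * (H.map u).prod := one_le_prodVal_mul hu h0
    _ ≤ η * (H.map u).prod * r * (H.map u).prod := by gcongr; exact h.trans (by gcongr)
    _ = η * (H.map u).prod ^ 2 * r := by ring
    _ ≤ 1 / 2 * r := by gcongr
    _ < 1 / 2 * 2 := by gcongr
    _ = 1 := by norm_num

end Penalty

namespace Gadget

variable {f : Constraint} {b : Bool} (G : Gadget f b) {n : ℕ}

theorem prodVal_trans_le {W η : ℝ≥0} (hW : G.D ≤ W) (hη : G.D ≤ G.κ * W * η) (v : ℕ)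
    (H : List (Application n)) (σ : ℕ → Bool) :
    prodVal (G.trans W v H) σ ≤ G.factor W v H * penVal b η H σ := by
  induction H generalizing v with
  | nil => simp [trans, factor, penVal, prodVal]
  | cons a H ih =>
    simp only [penVal, List.map_cons, List.prod_cons] at ih ⊢
    by_cases ha : a.con = forbid b
    · rw [G.trans_cons_of_forbid W v ha, G.factor_cons_of_forbid W v ha, prodVal_append,
        prodVal_emit, if_pos ha]
      have val_le : G.val f.val b W (fun l => σ (loc (a.arg 0) (a.arg 1) v l)) ≤
          G.κ * W * (if σ (a.arg 0) = b ∧ σ (a.arg 1) = b then η else 1) := by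
        split_ifs with hv
        · exact (G.val_le_of_forbidden W hW _ hv.1 hv.2).trans hη
        · exact (G.val_le W hW _ hv).trans_eq (mul_one _).symm
      refine (mul_le_mul' (ih (v + G.aux)) (mul_le_mul' val_le le_rfl)).trans_eq ?_
      ring
    · rw [G.trans_cons_of_ne W v ha, G.factor_cons_of_ne W v ha, prodVal_append, prodVal_cons,
        prodVal_nil, mul_one, if_neg ha]
      exact (mul_le_mul' (ih v) le_rfl).trans_eq (by ring)

theorem prodVal_le_mul_of_trans {W r : ℝ≥0} {H : List (Application n)}
    {u : Application n → ℝ≥0} (hu : ∀ a ∈ H, a.con.IsBoundedBy (u a)) (hD : G.D ≤ W)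
    (hκ : 2 * G.D * (H.map u).prod ^ 2 ≤ G.κ * W) (hr : r < 2) {σ : ℕ → Bool}
    (hσ : ∀ σ', prodVal (G.trans W n H) σ' ≤ prodVal (G.trans W n H) σ * r) (σ₀ : ℕ → Bool) :
    prodVal (H.map Application.raw) σ₀ ≤ prodVal (H.map Application.raw) σ * r := by
  rcases eq_or_ne (prodVal (H.map Application.raw) σ₀) 0 with h0 | h0
  · simp [h0]
  have hW : 0 < W := one_pos.trans_le (G.one_le_D.trans hD)
  have hκW : 0 < G.κ * W := mul_pos G.κ_pos hW
  have hη : G.D / (G.κ * W) * (H.map u).prod ^ 2 ≤ 1 / 2 := by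
    rw [div_mul_eq_mul_div, div_le_div_iff₀ hκW two_pos, one_mul]
    exact (by ring : _ = _).trans_le hκ
  refine prodVal_le_mul_of_le_penVal_mul (b := b) hu hr hη ?_
  obtain ⟨σ', -, hσ'⟩ := G.exists_prodVal_trans_eq hD le_rfl H σ₀ h0
  have trans_le := G.prodVal_trans_le hD (mul_div_cancel₀ G.D hκW.ne').ge n H σ
  refine le_of_mul_le_mul_left ?_ (G.factor_pos hW n H)
  calc G.factor W n H * prodVal (H.map Application.raw) σ₀ = prodVal (G.trans W n H) σ' := hσ'.symm
    _ ≤ prodVal (G.trans W n H) σ * r := hσ σ'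
    _ ≤ G.factor W n H * penVal b (G.D / (G.κ * W)) H σ * r := by gcongr
    _ = _ := mul_assoc _ _ _

theorem exists_target_inst (F : Set Constraint) (x : CSPInst ({forbid b} ∪ F ∪ U)) {W : ℝ≥0}
    {u : Application x.n → ℝ≥0} (hu : ∀ a ∈ x.H, a.con.IsBoundedBy (u a)) (hD : G.D ≤ W)
    (hκ : 2 * G.D * (x.H.map u).prod ^ 2 ≤ G.κ * W) (hW : (x.H.map u).prod < W) :
    ∃ w : CSPInst ({f} ∪ F ∪ U),
      w.enc = List.replicate (G.vEnd x.n x.H) 1 ++ 0 :: (G.trans W x.n x.H).flatMap RawApp.enc ∧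
      ∀ r : ℝ≥0, 1 ≤ r → r < 2 → ∀ y, (maxProdCSP ({f} ∪ F ∪ U)).IsApproxSol w r y →
        (maxProdCSP ({forbid b} ∪ F ∪ U)).IsApproxSol x r (y.take x.n) := by
  have val_lt : ∀ a ∈ x.H, ∀ z, a.con.val z < W := fun a ha z =>
    ((hu a ha).val_le z).trans_lt <| (List.single_le_prod
      (by simpa using fun a ha => (hu a ha).one_le) _ (List.mem_map_of_mem ha)).trans_lt hW
  obtain ⟨w, hwn, hwH⟩ := exists_inst_of_rawApps ({f} ∪ F ∪ U) (n := G.vEnd x.n x.H)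
    (G.nodup_trans le_rfl x.nodup val_lt)
    (fun e he v hv => (G.vars_of_mem_trans he hv).elim (·.trans_le (G.le_vEnd _ _)) And.right)
    (fun e he => G.con_mem_of_mem_trans x.mem he)
  refine ⟨w, by rw [w.enc_eq, hwH, hwn], fun r hr1 hr2 y hy => ?_⟩
  rw [isApproxSol_iff_forall_le _ hr1, hwH] at hy
  rw [isApproxSol_iff_forall_le _ hr1,
    prodVal_map_raw_congr x.H fun v hv => bits_take y hv]
  refine ⟨?_, G.prodVal_le_mul_of_trans hu hD hκ hr2 hy.2⟩
  rw [List.length_take, hy.1, hwn]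
  exact min_eq_left (G.le_vEnd _ _)

end Gadget

/-! ### Deterministic computations and reductions with one oracle call -/

/-- `Steps c t c'`: the machine passes from `c` to `c'` in `t` steps, none of which depends on coins
or on the oracle. -/
inductive Steps : Cfg → ℕ → Cfg → Prop
  | refl (c) : Steps c 0 c
  | head {c c₁ t c₂} : c.1.head? ≠ some Prog.query → (∀ M, step M c = PMF.pure c₁) →
      Steps c₁ t c₂ → Steps c (t + 1) c₂

namespace Steps

theorem single {c c₁} (hq : c.1.head? ≠ some Prog.query) (hstep : ∀ M, step M c = PMF.pure c₁) :
    Steps c 1 c₁ := .head hq hstep (.refl _)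

theorem trans {c t c₁ t' c₂} (h : Steps c t c₁) (h' : Steps c₁ t' c₂) :
    Steps c (t + t') c₂ := by
  induction h with
  | refl c => simpa only [Nat.zero_add] using h'
  | @head c c₁ t c₃ hq hstep _ ih =>
    rw [Nat.add_right_comm]
    exact .head hq hstep (ih h')

variable (M : List ℝ → PMF (List Bool))

theorem run_add {c t c'} (h : Steps c t c') (n : ℕ) : run M (t + n) c = run M n c' := by
  induction h with
  | refl c => rw [Nat.zero_add]
  | @head c c₁ t c₂ _ hstep _ ih =>
    rw [Nat.add_right_comm, run, hstep M, PMF.pure_bind, ih]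

theorem head?_ne_query {c t c'} (h : Steps c t c') {i : ℕ} (hi : i < t) {d : Cfg}
    (hd : d ∈ (run M i c).support) : d.1.head? ≠ some Prog.query := by
  induction h generalizing i with
  | refl c => exact absurd hi (Nat.not_lt_zero i)
  | @head c c₁ t _ hq hstep _ ih =>
    cases i with
    | zero =>
      obtain rfl : d = c := by simpa only [run, PMF.support_pure, Set.mem_singleton_iff] using hd
      exact hq
    | succ i =>
      rw [run, hstep M, PMF.pure_bind] at hd
      exact ih (Nat.lt_of_succ_lt_succ hi) hd

end Steps

section

variable (M : List ℝ → PMF (List Bool))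

theorem run_halted (n : ℕ) (s : Store) : run M n ([], s) = PMF.pure ([], s) := by
  induction n with
  | zero => rfl
  | succ n ih => rw [run, step, PMF.pure_bind, ih]

theorem Steps.run_of_halts {c t s} (h : Steps c t ([], s)) {n : ℕ} (hn : t ≤ n) :
    run M n c = PMF.pure ([], s) := by
  obtain ⟨k, rfl⟩ := Nat.exists_eq_add_of_le hn
  rw [h.run_add M, run_halted]

theorem Steps.head?_ne_query_of_halts {c t s} (h : Steps c t ([], s)) {n : ℕ} {d : Cfg}
    (hd : d ∈ (run M n c).support) : d.1.head? ≠ some Prog.query := by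
  rcases lt_or_ge n t with hn | hn
  · exact h.head?_ne_query M hn hd
  · rw [h.run_of_halts M hn, PMF.support_pure, Set.mem_singleton_iff] at hd
    simp only [hd, List.head?_nil, ne_eq, reduceCtorEq, not_false_eq_true]

/-- The store after the oracle has replied `y` to a query asked in the store `s`. -/
def answered (s : Store) (y : List Bool) : Store :=
  Function.update (Function.update s 1 []) 2 (y.map bit)

theorem run_query_succ (n : ℕ) (K : List Prog) (s : Store) :
    run M (n + 1) (.query :: K, s) = (M (s 1)).bind fun y => run M n (K, answered s y) := by
  rw [run, step, PMF.bind_map]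
  rfl

end

/-- `RunsIn p s s' b`: the program `p` takes the store `s` to the store `s'` in at most `b` steps,
without coins and without the oracle, whatever is left to be run after it. -/
def RunsIn (p : Prog) (s s' : Store) (b : ℕ) : Prop :=
  ∃ t ≤ b, ∀ K, Steps (p :: K, s) t (K, s')

namespace RunsIn

variable {p q : Prog} {c : Test} {s s₁ s₂ : Store} {b b' : ℕ}

theorem mono (h : RunsIn p s s₁ b) (hb : b ≤ b') : RunsIn p s s₁ b' := by
  obtain ⟨t, ht, hp⟩ := h
  exact ⟨t, ht.trans hb, hp⟩

theorem of_step (hq : p ≠ .query) (hstep : ∀ M K, step M (p :: K, s) = PMF.pure (K, s₁)) :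
    RunsIn p s s₁ 1 :=
  ⟨1, le_rfl, fun K => .single (by simpa using hq) fun M => hstep M K⟩

theorem seq (h : RunsIn p s s₁ b) (h' : RunsIn q s₁ s₂ b') :
    RunsIn (.seq p q) s s₂ (b + b' + 1) := by
  obtain ⟨t, ht, hp⟩ := h
  obtain ⟨t', ht', hq⟩ := h'
  exact ⟨t + t' + 1, by omega,
    fun K => .head (by simp) (fun M => rfl) ((hp (q :: K)).trans (hq K))⟩

theorem cond_pos (hc : c.Holds s) (h : RunsIn p s s₁ b) : RunsIn (.cond c p q) s s₁ (b + 1) := by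
  obtain ⟨t, ht, hp⟩ := h
  exact ⟨t + 1, by omega, fun K => .head (by simp) (fun M => by simp only [step, if_pos hc]) (hp K)⟩

theorem cond_neg (hc : ¬ c.Holds s) (h : RunsIn q s s₁ b) :
    RunsIn (.cond c p q) s s₁ (b + 1) := by
  obtain ⟨t, ht, hq⟩ := h
  exact ⟨t + 1, by omega, fun K => .head (by simp) (fun M => by simp only [step, if_neg hc]) (hq K)⟩

theorem loop_done (hc : ¬ c.Holds s) : RunsIn (.loop c p) s s 1 :=
  .of_step (by simp) fun M K => by simp only [step, if_neg hc]

theorem loop_step (hc : c.Holds s) (h : RunsIn p s s₁ b) (h' : RunsIn (.loop c p) s₁ s₂ b') :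
    RunsIn (.loop c p) s s₂ (b + b' + 1) := by
  obtain ⟨t, ht, hp⟩ := h
  obtain ⟨t', ht', hl⟩ := h'
  exact ⟨t + t' + 1, by omega, fun K =>
    .head (by simp) (fun M => by simp only [step, if_pos hc]) ((hp _).trans (hl K))⟩

end RunsIn

/-- The program that asks the query prepared by `A` and processes the answer by `B`. -/
def singleQuery (A B : Prog) : Prog := .seq A (.seq .query B)

section

variable {A B : Prog} {l : List ℝ} {s : Store} {b₁ b₂ : ℕ} {out : List Bool → Store}

theorem exists_steps_to_query (B : Prog)
    (hA : RunsIn A (Function.update (fun _ => []) 0 l) s b₁) :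
    ∃ t ≤ b₁ + 2, Steps (initCfg (singleQuery A B) l) t ([.query, B], s) := by
  obtain ⟨t, ht, hsteps⟩ := hA
  refine ⟨1 + t + 1, by omega, ?_⟩
  exact ((Steps.single (by simp [initCfg, singleQuery]) fun M => rfl).trans (hsteps _)).trans
    (.single (by simp) fun M => rfl)

theorem eq_of_head?_eq_query (hA : RunsIn A (Function.update (fun _ => []) 0 l) s b₁)
    (hB : ∀ y, RunsIn B (answered s y) (out y) b₂) (M : List ℝ → PMF (List Bool)) {n : ℕ}
    {c : Cfg} (hc : c ∈ (run M n (initCfg (singleQuery A B) l)).support)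
    (hquery : c.1.head? = some .query) : c = ([.query, B], s) := by
  obtain ⟨t, -, hsteps⟩ := exists_steps_to_query B hA
  rcases lt_or_ge n t with hn | hn
  · exact absurd hquery (hsteps.head?_ne_query M hn hc)
  obtain ⟨k, rfl⟩ := Nat.exists_eq_add_of_le hn
  rw [hsteps.run_add M] at hc
  cases k with
  | zero => simpa only [run, PMF.support_pure, Set.mem_singleton_iff] using hc
  | succ k =>
    rw [run_query_succ, PMF.mem_support_bind_iff] at hc
    obtain ⟨y, -, hcy⟩ := hc
    obtain ⟨t₂, -, hsteps₂⟩ := hB y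
    exact absurd hquery ((hsteps₂ []).head?_ne_query_of_halts M hcy)

theorem exists_run_singleQuery (hA : RunsIn A (Function.update (fun _ => []) 0 l) s b₁)
    (hB : ∀ y, RunsIn B (answered s y) (out y) b₂) :
    ∃ t ≤ b₁ + b₂ + 3, ∀ M : List ℝ → PMF (List Bool),
      run M t (initCfg (singleQuery A B) l) = (M (s 1)).map fun y => ([], out y) := by
  obtain ⟨t, ht, hsteps⟩ := exists_steps_to_query B hA
  refine ⟨t + (b₂ + 1), by omega, fun M => ?_⟩
  rw [hsteps.run_add M, run_query_succ, PMF.map]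
  congr 1
  funext y
  obtain ⟨t₂, ht₂, hsteps₂⟩ := hB y
  exact (hsteps₂ []).run_of_halts M ht₂

end

theorem aptReduces_of_singleQuery (P Q : MaxProblem) (A B : Prog) (p q : MvPolynomial (Fin 2) ℝ)
    (h : ∀ (x : P.Inst) (ε : ℝ), 0 < ε → ε < 1 → ∃ (w : Q.Inst) (δ : ℝ) (s : Store) (b₁ b₂ : ℕ)
      (out : List Bool → Store), 0 < δ ∧ δ < 1 ∧ 1 / δ ≤ polyVal p (P.size x) ε ∧
      s 1 = δ :: Q.enc w ∧
      RunsIn A (Function.update (fun _ => []) 0 (ε :: P.enc x)) s b₁ ∧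
      (∀ y, RunsIn B (answered s y) (out y) b₂) ∧
      ((b₁ + b₂ + 3 : ℕ) : ℝ) ≤ polyVal q (P.size x) ε ∧
      ∀ y, Q.IsApproxSol w (2 ^ δ) y →
        P.IsApproxSol x (2 ^ ε) ((out y 3).map fun r => decide (0 < r))) :
    APTReduces P Q := by
  refine ⟨singleQuery A B, p, q, fun M hM x ε hε0 hε1 => ?_⟩
  obtain ⟨w, δ, s, b₁, b₂, out, hδ0, hδ1, hp, hs, hA, hB, hq, happrox⟩ := h x ε hε0 hε1
  obtain ⟨t, ht, hrun⟩ := exists_run_singleQuery hA hB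
  refine ⟨fun n c hc hquery => ?_, t, le_trans (by exact_mod_cast ht) hq, fun c hc => ?_, ?_⟩
  · rw [eq_of_head?_eq_query hA hB M hc hquery]
    exact ⟨w, δ, hδ0, hδ1, hs, hp⟩
  · rw [hrun, PMF.support_map] at hc
    obtain ⟨y, -, rfl⟩ := hc
    rfl
  · have hscheme := hM w δ hδ0 hδ1
    unfold MaxProblem.ApproxLikely at hscheme ⊢
    rw [hrun, PMF.map_comp, PMF.toOuterMeasure_map_apply, hs]
    exact hscheme.trans (MeasureTheory.measure_mono happrox)

/-! ### Programs on named stacks -/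

/-- Names for the stacks that the reduction uses. The machine model fixes the roles of the first
four: input, oracle query, oracle answer and output. -/
inductive Reg where
  | input | query | answer | output | buffer | spare | weight | fresh | vars | accuracy
  | fst | snd | acc | tmp | counter

/-- The contents of the named stacks, each empty unless specified. -/
structure Tape where
  input : List ℝ := []
  query : List ℝ := []
  answer : List ℝ := []
  output : List ℝ := []
  buffer : List ℝ := []
  spare : List ℝ := []
  weight : List ℝ := []
  fresh : List ℝ := []
  vars : List ℝ := []
  accuracy : List ℝ := []
  fst : List ℝ := []
  snd : List ℝ := []
  acc : List ℝ := []
  tmp : List ℝ := []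
  counter : List ℝ := []

/-- The number of a named stack in the machine model. -/
def Reg.index : Reg → ℕ
  | input => 0
  | query => 1
  | answer => 2
  | output => 3
  | buffer => 4
  | spare => 5
  | weight => 6
  | fresh => 7
  | vars => 8
  | accuracy => 9
  | fst => 10
  | snd => 11
  | acc => 12
  | tmp => 13
  | counter => 14

namespace Tape

def toList (T : Tape) : List (List ℝ) :=
  [T.input, T.query, T.answer, T.output, T.buffer, T.spare, T.weight, T.fresh, T.vars, T.accuracy,
    T.fst, T.snd, T.acc, T.tmp, T.counter]

/-- The store in which the named stacks have the given contents and all others are empty. -/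
def store (T : Tape) : Store := fun i => T.toList.getD i []

def get (T : Tape) (r : Reg) : List ℝ := T.store r.index

def set (T : Tape) (l : List ℝ) : Reg → Tape
  | .input => { T with input := l }
  | .query => { T with query := l }
  | .answer => { T with answer := l }
  | .output => { T with output := l }
  | .buffer => { T with buffer := l }
  | .spare => { T with spare := l }
  | .weight => { T with weight := l }
  | .fresh => { T with fresh := l }
  | .vars => { T with vars := l }
  | .accuracy => { T with accuracy := l }
  | .fst => { T with fst := l }
  | .snd => { T with snd := l }
  | .acc => { T with acc := l }
  | .tmp => { T with tmp := l }
  | .counter => { T with counter := l }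

theorem toList_set (T : Tape) (l : List ℝ) (r : Reg) :
    (T.set l r).toList = T.toList.set r.index l := by
  cases r <;> rfl

theorem update_store (T : Tape) (r : Reg) (l : List ℝ) :
    Function.update T.store r.index l = (T.set l r).store := by
  have hr : r.index < T.toList.length := by cases r <;> simp [toList, Reg.index]
  funext i
  simp only [store, toList_set, List.getD_eq_getElem?_getD]
  rcases eq_or_ne i r.index with rfl | hi
  · rw [Function.update_self, List.getElem?_set_self hr, Option.getD_some]
  · rw [Function.update_of_ne hi, List.getElem?_set_ne hi.symm]
    rfl

theorem update_empty_zero (l : List ℝ) :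
    Function.update (fun _ => []) 0 l = store { input := l } := by
  have hempty : (fun _ => []) = store {} := by
    funext i
    rcases lt_or_ge i 15 with hi | hi
    · interval_cases i <;> rfl
    · exact (List.getD_eq_default _ _ hi).symm
  rw [hempty]
  exact update_store {} .input l

theorem answered_store (T : Tape) (y : List Bool) :
    answered T.store y = store { T with query := [], answer := y.map bit } := by
  rw [answered, show 1 = Reg.query.index from rfl, update_store,
    show 2 = Reg.answer.index from rfl, update_store]
  rfl

end Tape

/-- Commands without control flow. -/
inductive Cmd where
  | push (r : Reg) (c : ℝ)
  | pop (r : Reg)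
  | copy (r r' : Reg)
  | arith (op : ArithOp) (r : Reg)

namespace Cmd

/-- The command as a program of the machine model. -/
def prog : Cmd → Prog
  | push r c => .push r.index c
  | pop r => .pop r.index
  | copy r r' => .copy r.index r'.index
  | arith op r => .arith op r.index

/-- The effect of a command on the named stacks. -/
def exec (T : Tape) : Cmd → Tape
  | push r c => T.set (c :: T.get r) r
  | pop r => T.set (T.get r).tail r
  | copy r r' =>
    match T.get r with
    | [] => T
    | a :: _ => T.set (a :: T.get r') r'
  | arith op r =>
    match T.get r with
    | b :: a :: l => T.set (op.eval a b :: l) r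
    | _ => T

theorem runsIn_prog (c : Cmd) (T : Tape) : RunsIn c.prog T.store (c.exec T).store 1 := by
  cases c with
  | push r c =>
    rw [exec, ← Tape.update_store]
    exact .of_step (by simp [prog]) fun M K => rfl
  | pop r =>
    rw [exec, ← Tape.update_store]
    exact .of_step (by simp [prog]) fun M K => rfl
  | copy r r' =>
    have hcopy : (exec T (copy r r')).store = copyTop r.index r'.index T.store := by
      simp only [exec, copyTop, Tape.get]
      cases T.store r.index with
      | nil => rfl
      | cons a l => exact (Tape.update_store ..).symm
    rw [hcopy]
    exact .of_step (by simp [prog]) fun M K => rfl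
  | arith op r =>
    have harith : (exec T (arith op r)).store = arithTop op r.index T.store := by
      simp only [exec, arithTop, Tape.get]
      rcases T.store r.index with _ | ⟨b, _ | ⟨a, l⟩⟩
      · rfl
      · rfl
      · exact (Tape.update_store ..).symm
    rw [harith]
    exact .of_step (by simp [prog]) fun M K => rfl

end Cmd

/-- The commands of a list, one after the other. -/
def block : List Cmd → Prog
  | [] => .skip
  | c :: l => .seq c.prog (block l)

theorem runsIn_block (l : List Cmd) {T T' : Tape} (h : l.foldl Cmd.exec T = T') :
    RunsIn (block l) T.store T'.store (2 * l.length + 1) := by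
  induction l generalizing T with
  | nil =>
    subst h
    exact .of_step (by simp [block]) fun M K => rfl
  | cons c l ih =>
    refine ((c.runsIn_prog T).seq (ih h)).mono ?_
    rw [List.length_cons]
    omega

/-- Repeats the commands of `l` as long as the stack `r` is not empty. -/
def whileNonempty (r : Reg) (l : List Cmd) : Prog := .loop (.nonempty r.index) (block l)

/-- Repeats the commands of `l` as long as the top of the stack `r` is positive. -/
def whilePos (r : Reg) (l : List Cmd) : Prog := .loop (.pos r.index) (block l)

theorem holds_pos_iff {T : Tape} {r : Reg} {a : ℝ} {l : List ℝ} (h : T.get r = a :: l) :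
    (Test.pos r.index).Holds T.store ↔ 0 < a := by
  have hr : T.store r.index = a :: l := h
  simp [Test.Holds, hr]

theorem runsIn_whileNonempty_nil {T : Tape} {r : Reg} {l : List Cmd} (h : T.get r = []) :
    RunsIn (whileNonempty r l) T.store T.store 1 :=
  .loop_done fun hne => hne h

theorem runsIn_whileNonempty_cons {T T' : Tape} {r : Reg} {l : List Cmd} {s : Store} {b b' : ℕ}
    (hne : T.get r ≠ []) (hloop : RunsIn (whileNonempty r l) T'.store s b)
    (h : l.foldl Cmd.exec T = T') (hb : 2 * l.length + 2 + b ≤ b') :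
    RunsIn (whileNonempty r l) T.store s b' :=
  .mono (.loop_step hne (runsIn_block l h) hloop) (by omega)

theorem runsIn_whilePos_of_nonpos {T : Tape} {r : Reg} {a : ℝ} {t : List ℝ} {l : List Cmd}
    (h : T.get r = a :: t) (ha : a ≤ 0) : RunsIn (whilePos r l) T.store T.store 1 :=
  .loop_done ((holds_pos_iff h).not.2 ha.not_gt)

theorem runsIn_whilePos_of_pos {T T' : Tape} {r : Reg} {a : ℝ} {t : List ℝ} {l : List Cmd}
    {s : Store} {b b' : ℕ} (hr : T.get r = a :: t) (ha : 0 < a)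
    (hloop : RunsIn (whilePos r l) T'.store s b) (h : l.foldl Cmd.exec T = T')
    (hb : 2 * l.length + 2 + b ≤ b') :
    RunsIn (whilePos r l) T.store s b' :=
  .mono (.loop_step ((holds_pos_iff hr).2 ha) (runsIn_block l h) hloop) (by omega)

/-! ### Elementary loops -/

/-- The machine program that moves the buffer to the stack `r`, which reverses it. -/
def drain (r : Reg) : Prog := whileNonempty .buffer [.copy .buffer r, .pop .buffer]

theorem runsIn_drain {r : Reg} (hr : r ≠ .buffer) (T : Tape) (l : List ℝ) :
    RunsIn (drain r) (Tape.store { T with buffer := l })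
      (Tape.store { T.set (l.reverse ++ T.get r) r with buffer := [] }) (6 * l.length + 1) := by
  induction l generalizing T with
  | nil =>
    have hset : { T.set ([].reverse ++ T.get r) r with buffer := [] } =
        { T with buffer := [] } := by cases r <;> rfl
    rw [hset]
    exact runsIn_whileNonempty_nil rfl
  | cons a l ih =>
    have hset : { (T.set (a :: T.get r) r).set (l.reverse ++ (T.set (a :: T.get r) r).get r) r
          with buffer := [] } =
        { T.set ((a :: l).reverse ++ T.get r) r with buffer := [] } := by
      rw [List.reverse_cons, List.append_assoc]
      cases r <;> rfl
    rw [← hset]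
    refine runsIn_whileNonempty_cons (List.cons_ne_nil a l) (ih _) ?_ ?_
    · cases r <;> first | rfl | contradiction
    · simp only [List.length_cons, List.length_nil]
      omega

/-- The machine program that empties the stack `r`. -/
def clear (r : Reg) : Prog := whileNonempty r [.pop r]

theorem runsIn_clear {r : Reg} {T : Tape} {l : List ℝ} (hl : T.get r = l) :
    RunsIn (clear r) T.store (T.set [] r).store (4 * l.length + 1) := by
  induction l generalizing T with
  | nil =>
    have hset : T.set [] r = T := by rw [← hl]; cases r <;> rfl
    rw [hset]
    exact runsIn_whileNonempty_nil hl
  | cons a l ih =>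
    have hget : (T.set l r).get r = l := by cases r <;> rfl
    have hset : (T.set l r).set [] r = T.set [] r := by cases r <;> rfl
    rw [← hset]
    refine runsIn_whileNonempty_cons (by rw [hl]; exact List.cons_ne_nil a l) (ih hget) ?_ ?_
    · rw [List.foldl_cons, List.foldl_nil, Cmd.exec, hl, List.tail_cons]
    · simp only [List.length_cons, List.length_nil]
      omega

/-- The factor with which a cell `c` of the input enters the weight of the oracle query. It bounds
`c`, and it bounds `1 / c` unless `c = 0`, where `1 / c = 0` does no harm. -/
def cellFactor (c : ℝ) : ℝ := 1 / c + c + 1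

/-- The product of the factors of all cells of a string. -/
def cellProd (l : List ℝ) : ℝ := (l.map cellFactor).prod

theorem cellProd_cons (c : ℝ) (l : List ℝ) : cellProd (c :: l) = cellFactor c * cellProd l := by
  simp only [cellProd, List.map_cons, List.prod_cons]

/-- The machine program that moves the input to the buffer and multiplies the weight by the factors
of all cells. -/
def scan : Prog := whileNonempty .input
  [.copy .input .buffer, .push .acc 1, .copy .input .acc, .arith .div .acc, .copy .input .acc,
    .arith .add .acc, .push .acc 1, .arith .add .acc, .copy .acc .weight, .pop .acc,
    .arith .mul .weight, .pop .input]

theorem runsIn_scan (T : Tape) (w : ℝ) (l : List ℝ) :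
    RunsIn scan (Tape.store { T with input := l, weight := [w] })
      (Tape.store { T with
        input := []
        buffer := l.reverse ++ T.buffer
        weight := [w * cellProd l] })
      (26 * l.length + 1) := by
  induction l generalizing T w with
  | nil =>
    rw [cellProd, List.map_nil, List.prod_nil, mul_one]
    exact runsIn_whileNonempty_nil rfl
  | cons c l ih =>
    rw [cellProd_cons, ← mul_assoc, List.reverse_cons, List.append_assoc]
    refine runsIn_whileNonempty_cons (List.cons_ne_nil c l)
      (ih { T with buffer := c :: T.buffer } (w * cellFactor c)) rfl ?_
    simp only [List.length_cons, List.length_nil]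
    omega

/-- The machine program that reads the number of variables, which the input gives in unary. -/
def count : Prog := whilePos .input
  [.push .vars 1, .pop .input, .push .fresh 1, .arith .add .fresh]

theorem runsIn_count (T : Tape) (v : ℝ) (n : ℕ) (l : List ℝ) :
    RunsIn count
      (Tape.store { T with input := List.replicate n 1 ++ 0 :: l, fresh := [v] })
      (Tape.store { T with
        input := 0 :: l
        vars := List.replicate n 1 ++ T.vars
        fresh := [v + n] })
      (10 * n + 1) := by
  induction n generalizing T v with
  | zero =>
    rw [Nat.cast_zero, add_zero]
    exact runsIn_whilePos_of_nonpos rfl le_rfl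
  | succ n ih =>
    have hvars : List.replicate (n + 1) 1 ++ T.vars = List.replicate n 1 ++ 1 :: T.vars := by
      rw [List.replicate_succ', List.append_assoc, List.singleton_append]
    rw [hvars, Nat.cast_succ, add_comm (n : ℝ), ← add_assoc]
    refine runsIn_whilePos_of_pos rfl one_pos (ih { T with vars := 1 :: T.vars } (v + 1)) rfl ?_
    simp only [List.length_cons, List.length_nil]
    omega

/-- The machine program that multiplies the counter by `2 ^ k` if `k` is on the stack `tmp`. -/
def mulTwoPow : Prog := whilePos .tmp
  [.push .counter 2, .arith .mul .counter, .push .tmp 1, .arith .sub .tmp]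

theorem runsIn_mulTwoPow (T : Tape) (k : ℕ) (a : ℝ) :
    RunsIn mulTwoPow
      (Tape.store { T with tmp := (k : ℝ) :: T.tmp, counter := a :: T.counter })
      (Tape.store { T with tmp := 0 :: T.tmp, counter := a * 2 ^ k :: T.counter })
      (10 * k + 1) := by
  induction k generalizing a with
  | zero =>
    rw [Nat.cast_zero, pow_zero, mul_one]
    exact runsIn_whilePos_of_nonpos rfl le_rfl
  | succ k ih =>
    specialize ih (a * 2)
    rw [← add_sub_cancel_right (k : ℝ) 1, ← Nat.cast_succ] at ih
    rw [pow_succ', ← mul_assoc]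
    refine runsIn_whilePos_of_pos rfl (Nat.cast_pos.2 k.succ_pos) ih rfl ?_
    simp only [List.length_cons, List.length_nil]
    omega

/-- The machine program that moves as many cells as the counter says from the input to both the
buffer and the spare stack. -/
def fetch : Prog := whilePos .counter
  [.copy .input .buffer, .copy .input .spare, .pop .input, .push .counter 1, .arith .sub .counter]

theorem runsIn_fetch (T : Tape) (l r : List ℝ) :
    RunsIn fetch
      (Tape.store { T with input := l ++ r, counter := (l.length : ℝ) :: T.counter })
      (Tape.store { T with
        input := r
        buffer := l.reverse ++ T.buffer
        spare := l.reverse ++ T.spare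
        counter := 0 :: T.counter })
      (12 * l.length + 1) := by
  induction l generalizing T with
  | nil =>
    rw [List.length_nil, Nat.cast_zero]
    exact runsIn_whilePos_of_nonpos rfl le_rfl
  | cons c l ih =>
    specialize ih { T with buffer := c :: T.buffer, spare := c :: T.spare }
    rw [← add_sub_cancel_right (l.length : ℝ) 1, ← Nat.cast_succ] at ih
    rw [List.reverse_cons, List.append_assoc, List.append_assoc]
    refine runsIn_whilePos_of_pos rfl (Nat.cast_pos.2 l.length.succ_pos) ih rfl ?_
    simp only [List.length_cons, List.length_nil]
    omega

/-- The machine program that writes the number of variables of the query in unary. -/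
def ones : Prog := whilePos .fresh [.push .query 1, .push .fresh 1, .arith .sub .fresh]

theorem runsIn_ones (T : Tape) (v : ℕ) :
    RunsIn ones (Tape.store { T with fresh := [(v : ℝ)] })
      (Tape.store { T with
        query := List.replicate v 1 ++ T.query
        fresh := [0] })
      (8 * v + 1) := by
  induction v generalizing T with
  | zero =>
    rw [Nat.cast_zero]
    exact runsIn_whilePos_of_nonpos rfl le_rfl
  | succ v ih =>
    specialize ih { T with query := 1 :: T.query }
    rw [← add_sub_cancel_right (v : ℝ) 1, ← Nat.cast_succ] at ih
    have hquery : List.replicate (v + 1) 1 ++ T.query = List.replicate v 1 ++ 1 :: T.query := by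
      rw [List.replicate_succ', List.append_assoc, List.singleton_append]
    rw [hquery]
    refine runsIn_whilePos_of_pos rfl (Nat.cast_pos.2 v.succ_pos) ih rfl ?_
    simp only [List.length_cons, List.length_nil]
    omega

/-- The machine program that moves one cell of the answer to the buffer for every variable. -/
def take : Prog := whileNonempty .vars [.copy .answer .buffer, .pop .answer, .pop .vars]

theorem runsIn_take (T : Tape) (y l : List ℝ) :
    RunsIn take (Tape.store { T with answer := y, vars := l })
      (Tape.store { T with
        answer := y.drop l.length
        buffer := (y.take l.length).reverse ++ T.buffer
        vars := [] })
      (8 * l.length + 1) := by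
  induction l generalizing T y with
  | nil => exact runsIn_whileNonempty_nil rfl
  | cons c l ih =>
    cases y with
    | nil =>
      specialize ih T []
      rw [List.take_nil, List.drop_nil] at ih ⊢
      refine runsIn_whileNonempty_cons (List.cons_ne_nil c l) ih rfl ?_
      simp only [List.length_cons, List.length_nil]
      omega
    | cons a y =>
      rw [List.length_cons, List.take_succ_cons, List.drop_succ_cons, List.reverse_cons,
        List.append_assoc]
      refine runsIn_whileNonempty_cons (List.cons_ne_nil c l)
        (ih { T with buffer := a :: T.buffer } y) rfl ?_
      simp only [List.length_cons, List.length_nil]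
      omega

/-! ### Translating one application -/

/-- Arithmetic expressions for the cells of a copy of a gadget, in terms of the weight, the number
of variables so far and the two arguments. -/
inductive CellExpr where
  | const (c : ℝ)
  | weight
  | fresh
  | fst
  | snd
  | add (e e' : CellExpr)
  | mul (e e' : CellExpr)

namespace CellExpr

/-- The value of an expression. -/
def eval (W v i j : ℝ) : CellExpr → ℝ
  | const c => c
  | weight => W
  | fresh => v
  | fst => i
  | snd => j
  | add e e' => e.eval W v i j + e'.eval W v i j
  | mul e e' => e.eval W v i j * e'.eval W v i j

/-- Commands that push the value of an expression on the query stack. -/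
def code : CellExpr → List Cmd
  | const c => [.push .query c]
  | weight => [.copy .weight .query]
  | fresh => [.copy .fresh .query]
  | fst => [.copy .fst .query]
  | snd => [.copy .snd .query]
  | add e e' => e.code ++ e'.code ++ [.arith .add .query]
  | mul e e' => e.code ++ e'.code ++ [.arith .mul .query]

/-- Commands that push the values of a list of expressions on the query stack, the first value
on top. -/
def codeList : List CellExpr → List Cmd
  | [] => []
  | e :: l => codeList l ++ e.code

section

variable (T : Tape) (W v i j : ℝ)

theorem foldl_exec_code (e : CellExpr) :
    e.code.foldl Cmd.exec
        { T with weight := [W], fresh := [v], fst := i :: T.fst, snd := j :: T.snd } =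
      { T with
        query := e.eval W v i j :: T.query
        weight := [W]
        fresh := [v]
        fst := i :: T.fst
        snd := j :: T.snd } := by
  induction e generalizing T with
  | add e e' he he' =>
    simp only [code, List.foldl_append, he T]
    exact congrArg (Cmd.exec · (.arith .add .query))
      (he' { T with query := e.eval W v i j :: T.query })
  | mul e e' he he' =>
    simp only [code, List.foldl_append, he T]
    exact congrArg (Cmd.exec · (.arith .mul .query))
      (he' { T with query := e.eval W v i j :: T.query })
  | _ => rfl

theorem foldl_exec_codeList (l : List CellExpr) :
    (codeList l).foldl Cmd.exec
        { T with weight := [W], fresh := [v], fst := i :: T.fst, snd := j :: T.snd } =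
      { T with
        query := l.map (eval W v i j) ++ T.query
        weight := [W]
        fresh := [v]
        fst := i :: T.fst
        snd := j :: T.snd } := by
  induction l with
  | nil => rfl
  | cons e l ih =>
    rw [codeList, List.foldl_append, ih]
    exact foldl_exec_code { T with query := l.map (eval W v i j) ++ T.query } W v i j e

end

/-- The index of the variable that a local variable of a gadget stands for, see `loc`. -/
def ofLocal : ℕ → CellExpr
  | 0 => fst
  | 1 => snd
  | l + 2 => add fresh (const l)

theorem eval_ofLocal (W : ℝ) (v i j l : ℕ) : (ofLocal l).eval W v i j = (loc i j v l : ℕ) := by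
  rcases l with _ | _ | l
  · rfl
  · rfl
  · exact (Nat.cast_add v l).symm

/-- The cells of an application of `scaled b c d` to the variable `i`. -/
def scaledCells (b : Bool) (c : ℝ≥0) (d i : CellExpr) : List CellExpr :=
  [const 1, if b then d else mul (const c) d, if b then mul (const c) d else d, i]

end CellExpr

theorem enc_unary (c d : ℝ≥0) (u : ℕ) :
    RawApp.enc ⟨unary c d, fun _ => u⟩ = [1, (c : ℝ), (d : ℝ), (u : ℝ)] := by
  simp [RawApp.enc, unary, table]

theorem CellExpr.map_eval_scaledCells (W : ℝ) (v i j : ℕ) (b : Bool) (c d : ℝ≥0) (u : ℕ)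
    {e e' : CellExpr} (hd : e.eval W v i j = d) (hu : e'.eval W v i j = u) :
    (scaledCells b c e e').map (eval W v i j) = RawApp.enc ⟨scaled b c d, fun _ => u⟩ := by
  rw [scaled, enc_unary]
  cases b <;> simp [scaledCells, eval, hd, hu]

namespace Gadget

variable {f : Constraint} {b : Bool} (G : Gadget f b)

open CellExpr in
/-- The cells of a copy of a gadget, see `Gadget.emit`. -/
def cells : List CellExpr :=
  ((G.scopes.flatMap fun s => const f.arity ::
    ((table f.arity f.val).map const ++ List.ofFn fun l => ofLocal (s l))) ++
  ((List.range G.aux).flatMap fun l =>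
    [const 1, add (const (G.weight l false).1) (mul (const (G.weight l false).2) weight),
      add (const (G.weight l true).1) (mul (const (G.weight l true).2) weight),
      add .fresh (const l)])) ++
  (scaledCells b G.left (add weight .fresh) fst ++
    scaledCells b G.right (add (add weight .fresh) (const 1)) snd)

theorem map_eval_cells (W : ℝ≥0) (v i j : ℕ) :
    G.cells.map (CellExpr.eval W v i j) = (G.emit W v i j).flatMap RawApp.enc := by
  rw [cells, emit, innerApps, outerApps]
  simp only [List.map_append, List.flatMap_append, List.flatMap_cons, List.flatMap_nil,
    List.append_nil, List.map_flatMap, List.flatMap_map]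
  congr 1
  · congr 2
    · funext s
      rw [List.map_cons, List.map_append, List.map_map, List.map_ofFn]
      congr 2
      · exact List.map_id _
      · congr 1
        funext l
        exact CellExpr.eval_ofLocal W v i j (s l)
    · funext l
      rw [enc_unary]
      simp [CellExpr.eval]
  · congr 1 <;> apply CellExpr.map_eval_scaledCells <;> simp [CellExpr.eval]

end Gadget

/-- The machine program that moves the first application of the input to the buffer and to the spare
stack and pushes `(k - 2) ^ 2` on the accumulator, where `k` is the arity. -/
def parse : Prog :=
  .seq (block [.copy .input .tmp, .push .counter 1]) (.seq mulTwoPow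
    (.seq (block [.pop .tmp, .copy .input .counter, .arith .add .counter, .push .counter 1,
      .arith .add .counter, .copy .input .acc, .push .acc 2, .arith .sub .acc, .copy .acc .acc,
      .arith .mul .acc]) (.seq fetch (block [.pop .counter]))))

theorem Application.length_enc {n : ℕ} (a : Application n) :
    a.enc.length = 2 ^ a.con.arity + a.con.arity + 1 := by
  rw [enc, List.length_cons, List.length_append, table_length, List.length_ofFn]

theorem runsIn_parse (T : Tape) {n : ℕ} (a : Application n) (r : List ℝ) :
    RunsIn parse (Tape.store { T with input := a.enc ++ r })
      (Tape.store { T with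
        input := r
        buffer := a.enc.reverse ++ T.buffer
        spare := a.enc.reverse ++ T.spare
        acc := ((a.con.arity : ℝ) - 2) * ((a.con.arity : ℝ) - 2) :: T.acc })
      (22 * a.enc.length + 35) := by
  have hlen : (a.enc.length : ℝ) = 1 * 2 ^ a.con.arity + a.con.arity + 1 := by
    rw [a.length_enc]
    push_cast
    ring
  have hle : a.con.arity ≤ a.enc.length := by
    rw [a.length_enc]
    exact (Nat.le_add_left _ _).trans (Nat.le_succ _)
  refine RunsIn.mono (.seq (runsIn_block _ (T' := { T with
      input := a.enc ++ r
      tmp := (a.con.arity : ℝ) :: T.tmp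
      counter := 1 :: T.counter }) rfl)
    (.seq (runsIn_mulTwoPow { T with input := a.enc ++ r } a.con.arity 1)
    (.seq (runsIn_block _ (T' := { T with
      input := a.enc ++ r
      acc := ((a.con.arity : ℝ) - 2) * ((a.con.arity : ℝ) - 2) :: T.acc
      counter := (a.enc.length : ℝ) :: T.counter }) (by rw [hlen]; rfl))
    (.seq (runsIn_fetch { T with
        acc := ((a.con.arity : ℝ) - 2) * ((a.con.arity : ℝ) - 2) :: T.acc } a.enc r)
      (runsIn_block _ rfl))))) ?_
  simp only [List.length_cons, List.length_nil]
  omega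

/-- The sum of the squared differences of two lists of the same length. -/
def sqDist (l l' : List ℝ) : ℝ := (List.zipWith (fun t c => (t - c) * (t - c)) l l').sum

theorem sqDist_cons (t c : ℝ) (l l' : List ℝ) :
    sqDist (t :: l) (c :: l') = (t - c) * (t - c) + sqDist l l' := by
  rw [sqDist, List.zipWith_cons_cons, List.sum_cons, sqDist]

theorem sqDist_nonneg (l l' : List ℝ) : 0 ≤ sqDist l l' := by
  induction l generalizing l' with
  | nil => exact le_of_eq (by rw [sqDist, List.zipWith_nil_left, List.sum_nil])
  | cons t l ih =>
    cases l' with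
    | nil => exact le_of_eq (by rw [sqDist, List.zipWith_nil_right, List.sum_nil])
    | cons c l' =>
      rw [sqDist_cons]
      exact add_nonneg (mul_self_nonneg _) (ih l')

theorem sqDist_eq_zero_iff {l l' : List ℝ} (h : l.length = l'.length) :
    sqDist l l' = 0 ↔ l = l' := by
  induction l generalizing l' with
  | nil => simp [sqDist, List.length_eq_zero_iff.1 h.symm]
  | cons t l ih =>
    obtain ⟨c, l', rfl⟩ := List.exists_cons_of_length_eq_add_one h.symm
    rw [sqDist_cons, add_eq_zero_iff_of_nonneg (mul_self_nonneg _) (sqDist_nonneg l l'),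
      mul_self_eq_zero, sub_eq_zero, ih (Nat.succ_injective h), List.cons.injEq]

/-- Commands that compare the top of the spare stack with the constant `c`. -/
def compareTop (c : ℝ) : List Cmd :=
  [.push .spare c, .arith .sub .spare, .copy .spare .spare, .arith .mul .spare, .copy .spare .acc,
    .arith .add .acc, .pop .spare]

theorem foldl_exec_compareTop (T : Tape) (t c d : ℝ) (l u : List ℝ) :
    (compareTop c).foldl Cmd.exec { T with spare := t :: l, acc := d :: u } =
      { T with spare := l, acc := (d + (t - c) * (t - c)) :: u } := by
  simp [compareTop, Cmd.exec, Tape.set, Tape.get, Tape.store, Tape.toList, Reg.index,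
    ArithOp.eval]

theorem foldl_exec_flatMap_compareTop (T : Tape) (l l' r u : List ℝ)
    (h : l.length = l'.length) (d : ℝ) :
    (l'.flatMap compareTop).foldl Cmd.exec { T with spare := l ++ r, acc := d :: u } =
      { T with spare := r, acc := (d + sqDist l l') :: u } := by
  induction l generalizing l' d with
  | nil =>
    rw [List.length_eq_zero_iff.1 h.symm, sqDist, List.zipWith_nil_left, List.sum_nil, add_zero]
    rfl
  | cons t l ih =>
    obtain ⟨c, l', rfl⟩ := List.exists_cons_of_length_eq_add_one h.symm
    rw [sqDist_cons, ← add_assoc, List.flatMap_cons, List.foldl_append, List.cons_append,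
      foldl_exec_compareTop]
    exact ih l' (Nat.succ_injective h) (d + (t - c) * (t - c))

theorem length_flatMap_compareTop (l : List ℝ) : (l.flatMap compareTop).length = 7 * l.length := by
  induction l with
  | nil => rfl
  | cons c l ih =>
    rw [List.flatMap_cons, List.length_append, ih, List.length_cons]
    exact (Nat.add_comm _ _).trans (Nat.mul_succ 7 _).symm

/-- The table of values of `forbid b`, the last value first. -/
def forbidTable (b : Bool) : List ℝ :=
  (table (forbid b).arity (forbid b).val).reverse

/-- The machine program that moves the first application of the input to the buffer, pushes its
first two arguments on the stacks `fst` and `snd` if it is binary, and decides whether its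
constraint is `forbid b`: it pushes a positive number on the accumulator if not, and `0` if so. -/
def recognize (b : Bool) : Prog :=
  .seq parse (.cond (.pos Reg.acc.index) (block [.push .fst 0, .push .snd 0])
    (block ([.copy .spare .snd, .pop .spare, .copy .spare .fst, .pop .spare] ++
      (forbidTable b).flatMap compareTop)))

theorem Application.reverse_enc_of_arity_eq_two {n : ℕ} (a : Application n)
    (ha : a.con.arity = 2) :
    a.enc.reverse = (a.arg 1 : ℝ) :: (a.arg 0 : ℝ) :: ((table a.con.arity a.con.val).reverse ++
      [(a.con.arity : ℝ)]) := by
  obtain ⟨⟨k, h⟩, v⟩ := a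
  obtain rfl : k = 2 := ha
  simp [enc, arg, raw, RawApp.vars]

theorem Constraint.eq_forbid_iff {h : Constraint} (hh : h.arity = 2) (b : Bool) :
    h = forbid b ↔ (table h.arity h.val).reverse = forbidTable b := by
  obtain ⟨k, h⟩ := h
  obtain rfl : k = 2 := hh
  refine ⟨fun heq => by rw [heq]; rfl, fun htable => ?_⟩
  obtain rfl := table_injective 2 (List.reverse_injective htable)
  rfl

theorem length_forbidTable (b : Bool) : (forbidTable b).length = 4 := by
  rw [forbidTable, List.length_reverse, table_length]
  rfl

theorem Constraint.length_reverse_table {h : Constraint} (hh : h.arity = 2) (b : Bool) :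
    (table h.arity h.val).reverse.length = (forbidTable b).length := by
  rw [length_forbidTable, List.length_reverse, table_length, hh]
  rfl

section

variable (b : Bool) (T : Tape) {n : ℕ} (a : Application n) (r : List ℝ)

theorem runsIn_recognize_of_arity_ne_two (ha : a.con.arity ≠ 2) :
    RunsIn (recognize b) (Tape.store { T with input := a.enc ++ r })
      (Tape.store { T with
        input := r
        buffer := a.enc.reverse ++ T.buffer
        spare := a.enc.reverse ++ T.spare
        fst := 0 :: T.fst
        snd := 0 :: T.snd
        acc := ((a.con.arity : ℝ) - 2) * ((a.con.arity : ℝ) - 2) :: T.acc })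
      (22 * a.enc.length + 42) := by
  have hpos : 0 < ((a.con.arity : ℝ) - 2) * ((a.con.arity : ℝ) - 2) :=
    mul_self_pos.2 (sub_ne_zero.2 (by exact_mod_cast ha))
  refine RunsIn.mono (.seq (runsIn_parse T a r)
    (.cond_pos ((holds_pos_iff rfl).2 hpos) (runsIn_block _ rfl))) ?_
  simp only [List.length_cons, List.length_nil]
  omega

theorem runsIn_recognize_of_arity_eq_two (ha : a.con.arity = 2) :
    RunsIn (recognize b) (Tape.store { T with input := a.enc ++ r })
      (Tape.store { T with
        input := r
        buffer := a.enc.reverse ++ T.buffer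
        spare := (a.con.arity : ℝ) :: T.spare
        fst := a.arg 0 :: T.fst
        snd := a.arg 1 :: T.snd
        acc := sqDist (table a.con.arity a.con.val).reverse (forbidTable b) :: T.acc })
      (22 * a.enc.length + 102) := by
  have hparse := runsIn_parse T a r
  have hzero : ((a.con.arity : ℝ) - 2) * ((a.con.arity : ℝ) - 2) = 0 := by
    rw [ha, Nat.cast_ofNat, sub_self, mul_zero]
  have hlen := Constraint.length_reverse_table ha b
  have hcompare := foldl_exec_flatMap_compareTop { T with
    input := r
    buffer := a.enc.reverse ++ T.buffer
    fst := a.arg 0 :: T.fst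
    snd := a.arg 1 :: T.snd } _ _ ((a.con.arity : ℝ) :: T.spare) T.acc hlen 0
  rw [zero_add] at hcompare
  rw [hzero] at hparse
  refine RunsIn.mono (.seq hparse (.cond_neg ((holds_pos_iff rfl).not.2 (lt_irrefl 0))
    (runsIn_block _ ?_))) ?_
  · rw [List.foldl_append, ← hcompare, a.reverse_enc_of_arity_eq_two ha]
    simp only [List.cons_append, List.append_assoc, List.nil_append]
    rfl
  · rw [List.length_append, length_flatMap_compareTop, length_forbidTable]
    simp only [List.length_cons, List.length_nil]
    omega

theorem exists_runsIn_recognize :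
    ∃ (s : List ℝ) (i j d : ℝ), s.length ≤ a.enc.length ∧ (0 < d ↔ a.con ≠ forbid b) ∧
      (a.con = forbid b → i = a.arg 0 ∧ j = a.arg 1) ∧
      RunsIn (recognize b) (Tape.store { T with input := a.enc ++ r, buffer := [], spare := [] })
        (Tape.store { T with
          input := r
          buffer := a.enc.reverse
          spare := s
          fst := i :: T.fst
          snd := j :: T.snd
          acc := d :: T.acc })
        (22 * a.enc.length + 102) := by
  by_cases ha : a.con.arity = 2
  · have hrun := runsIn_recognize_of_arity_eq_two b { T with buffer := [], spare := [] } a r ha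
    simp only [List.append_nil] at hrun
    refine ⟨_, _, _, _, ?_, ?_, fun _ => ⟨rfl, rfl⟩, hrun⟩
    · rw [a.length_enc, List.length_singleton]
      exact Nat.le_add_left _ _
    · rw [(sqDist_nonneg _ _).lt_iff_ne', Ne,
        sqDist_eq_zero_iff (Constraint.length_reverse_table ha b), ← Constraint.eq_forbid_iff ha]
  · have hrun := runsIn_recognize_of_arity_ne_two b { T with buffer := [], spare := [] } a r ha
    simp only [List.append_nil] at hrun
    have hne : a.con ≠ forbid b := fun h => ha (by rw [h]; rfl)
    refine ⟨_, _, _, _, List.length_reverse.le, iff_of_true (mul_self_pos.2 ?_) hne,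
      fun h => absurd h hne, hrun.mono (by omega)⟩
    exact sub_ne_zero.2 (by exact_mod_cast ha)

end

namespace Gadget

variable {f : Constraint} {b : Bool} (G : Gadget f b)

/-- The machine program that writes the copy of the gadget with the arguments on the stacks `fst`
and `snd` on the query stack and drops the application in the buffer. -/
def replace : Prog :=
  .seq (block (CellExpr.codeList G.cells ++ [.push .fresh G.aux, .arith .add .fresh]))
    (clear .buffer)

theorem runsIn_replace (T : Tape) (l : List ℝ) (W : ℝ≥0) (v i j : ℕ) :
    RunsIn G.replace
      (Tape.store { T with
        buffer := l
        weight := [(W : ℝ)]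
        fresh := [(v : ℝ)]
        fst := i :: T.fst
        snd := j :: T.snd })
      (Tape.store { T with
        query := (G.emit W v i j).flatMap RawApp.enc ++ T.query
        buffer := []
        weight := [(W : ℝ)]
        fresh := [((v + G.aux : ℕ) : ℝ)]
        fst := i :: T.fst
        snd := j :: T.snd })
      (2 * (CellExpr.codeList G.cells).length + 4 * l.length + 7) := by
  rw [← map_eval_cells, Nat.cast_add]
  refine RunsIn.mono (.seq (runsIn_block _ ?_) (runsIn_clear (r := .buffer) (T := { T with
    query := G.cells.map (CellExpr.eval W v i j) ++ T.query
    buffer := l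
    weight := [(W : ℝ)]
    fresh := [(v : ℝ) + G.aux]
    fst := i :: T.fst
    snd := j :: T.snd }) (l := l) rfl)) ?_
  · rw [List.foldl_append, CellExpr.foldl_exec_codeList { T with buffer := l }]
    rfl
  · simp only [List.length_append, List.length_cons, List.length_nil]
    omega

/-- The machine program that translates the first application of the input. -/
def translateApp : Prog :=
  .seq (recognize b) (.seq (.cond (.pos Reg.acc.index) (drain .query) G.replace)
    (.seq (clear .spare) (block [.pop .fst, .pop .snd, .pop .acc])))

variable (T : Tape) (W : ℝ≥0) (v : ℕ) {n : ℕ} {a : Application n} (r : List ℝ)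

theorem runsIn_translateApp_of_forbid (ha : a.con = forbid b) :
    RunsIn G.translateApp
      (Tape.store { T with
        input := a.enc ++ r
        buffer := []
        spare := []
        weight := [(W : ℝ)]
        fresh := [(v : ℝ)] })
      (Tape.store { T with
        input := r
        query := (G.emit W v (a.arg 0) (a.arg 1)).flatMap RawApp.enc ++ T.query
        buffer := []
        spare := []
        weight := [(W : ℝ)]
        fresh := [((v + G.aux : ℕ) : ℝ)] })
      (32 * a.enc.length + 2 * (CellExpr.codeList G.cells).length + 130) := by
  obtain ⟨s, i, j, d, hs, hd, hij, hrecognize⟩ :=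
    exists_runsIn_recognize b { T with weight := [(W : ℝ)], fresh := [(v : ℝ)] } a r
  obtain ⟨rfl, rfl⟩ := hij ha
  refine RunsIn.mono (.seq hrecognize (.seq
    (.cond_neg ((holds_pos_iff rfl).not.2 (hd.not.2 (not_not.2 ha)))
      (G.runsIn_replace { T with input := r, spare := s, acc := d :: T.acc } a.enc.reverse
        W v (a.arg 0) (a.arg 1)))
    (.seq (runsIn_clear (l := s) rfl) (runsIn_block _ rfl)))) ?_
  simp only [List.length_cons, List.length_nil, List.length_reverse]
  omega

theorem runsIn_translateApp_of_ne (ha : a.con ≠ forbid b) :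
    RunsIn G.translateApp
      (Tape.store { T with
        input := a.enc ++ r
        buffer := []
        spare := []
        weight := [(W : ℝ)]
        fresh := [(v : ℝ)] })
      (Tape.store { T with
        input := r
        query := a.enc ++ T.query
        buffer := []
        spare := []
        weight := [(W : ℝ)]
        fresh := [(v : ℝ)] })
      (32 * a.enc.length + 2 * (CellExpr.codeList G.cells).length + 130) := by
  obtain ⟨s, i, j, d, hs, hd, -, hrecognize⟩ :=
    exists_runsIn_recognize b { T with weight := [(W : ℝ)], fresh := [(v : ℝ)] } a r
  have hdrain := runsIn_drain (r := .query) (by simp) { T with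
    input := r
    spare := s
    weight := [(W : ℝ)]
    fresh := [(v : ℝ)]
    fst := i :: T.fst
    snd := j :: T.snd
    acc := d :: T.acc } a.enc.reverse
  rw [List.reverse_reverse] at hdrain
  refine RunsIn.mono (.seq hrecognize (.seq (.cond_pos ((holds_pos_iff rfl).2 (hd.2 ha)) hdrain)
    (.seq (runsIn_clear (l := s) rfl) (runsIn_block _ rfl)))) ?_
  simp only [List.length_cons, List.length_nil, List.length_reverse]
  omega

/-- The machine program that translates all applications of the input. -/
def translate : Prog := .loop (.nonempty Reg.input.index) G.translateApp

theorem runsIn_translate (H : List (Application n)) :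
    RunsIn G.translate
      (Tape.store { T with
        input := H.flatMap Application.enc
        buffer := []
        spare := []
        weight := [(W : ℝ)]
        fresh := [(v : ℝ)] })
      (Tape.store { T with
        input := []
        query := (G.trans W v H).flatMap RawApp.enc ++ T.query
        buffer := []
        spare := []
        weight := [(W : ℝ)]
        fresh := [(G.vEnd v H : ℝ)] })
      ((2 * (CellExpr.codeList G.cells).length + 164) * (H.flatMap Application.enc).length +
        1) := by
  induction H generalizing T v with
  | nil => exact .loop_done fun hne => hne rfl
  | cons a H ih =>
    rw [List.flatMap_cons]
    have hbound : ∀ c t : ℕ, 32 * a.enc.length + c + 130 + ((c + 164) * t + 1) + 1 ≤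
        (c + 164) * (a.enc.length + t) + 1 := fun c t => by
      have hlen : 1 ≤ a.enc.length := Nat.succ_pos _
      nlinarith [Nat.mul_le_mul_left c hlen]
    have hne : a.enc ++ H.flatMap Application.enc ≠ [] := List.cons_ne_nil _ _
    by_cases ha : a.con = forbid b
    · rw [G.trans_cons_of_forbid W v ha, G.vEnd_cons_of_forbid v ha, List.flatMap_append,
        List.append_assoc, List.length_append]
      exact .mono (.loop_step hne (G.runsIn_translateApp_of_forbid T W v _ ha)
        (ih { T with
          query := (G.emit W v (a.arg 0) (a.arg 1)).flatMap RawApp.enc ++ T.query } _))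
        (hbound _ _)
    · rw [G.trans_cons_of_ne W v ha, G.vEnd_cons_of_ne v ha, List.flatMap_append,
        List.append_assoc, List.length_append, List.flatMap_singleton]
      exact .mono (.loop_step hne (G.runsIn_translateApp_of_ne T W v _ ha)
        (ih { T with query := a.enc ++ T.query } _)) (hbound _ _)

theorem vEnd_le (H : List (Application n)) :
    G.vEnd v H ≤ v + G.aux * (H.flatMap Application.enc).length := by
  induction H generalizing v with
  | nil => exact Nat.le_add_right _ _
  | cons a H ih =>
    rw [List.flatMap_cons, List.length_append, mul_add]
    have haux : G.aux ≤ G.aux * a.enc.length := Nat.le_mul_of_pos_right _ (Nat.succ_pos _)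
    by_cases ha : a.con = forbid b
    · rw [G.vEnd_cons_of_forbid v ha]
      exact (ih _).trans (by omega)
    · rw [G.vEnd_cons_of_ne v ha]
      exact (ih _).trans (by omega)

end Gadget

/-! ### The reduction given by a gadget -/

theorem one_le_cellFactor {c : ℝ} (h : 0 ≤ c) : 1 ≤ cellFactor c :=
  le_add_of_nonneg_left (add_nonneg (one_div_nonneg.2 h) h)

theorem le_cellFactor {c : ℝ} (h : 0 ≤ c) : c ≤ cellFactor c := by
  have hinv : 0 ≤ 1 / c := one_div_nonneg.2 h
  rw [cellFactor]
  linarith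

theorem one_le_mul_cellFactor {c : ℝ} (h : 0 < c) : 1 ≤ c * cellFactor c := by
  rw [cellFactor, mul_add, mul_add, mul_one_div_cancel h.ne', add_assoc]
  exact le_add_of_nonneg_right (by positivity)

theorem cellProd_append (l l' : List ℝ) : cellProd (l ++ l') = cellProd l * cellProd l' := by
  simp only [cellProd, List.map_append, List.prod_append]

theorem one_le_cellProd {l : List ℝ} (h : ∀ c ∈ l, 0 ≤ c) : 1 ≤ cellProd l := by
  induction l with
  | nil => exact le_rfl
  | cons c l ih =>
    rw [cellProd_cons]
    exact one_le_mul_of_one_le_of_one_le (one_le_cellFactor (h c List.mem_cons_self))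
      (ih fun d hd => h d (List.mem_cons_of_mem c hd))

theorem cellFactor_le_cellProd {l : List ℝ} (h : ∀ c ∈ l, 0 ≤ c) {c : ℝ} (hc : c ∈ l) :
    cellFactor c ≤ cellProd l := by
  have hpos : 0 ≤ cellFactor c := zero_le_one.trans (one_le_cellFactor (h c hc))
  obtain ⟨l₁, l₂, rfl⟩ := List.append_of_mem hc
  rw [cellProd_append, cellProd_cons, mul_left_comm]
  refine le_mul_of_one_le_right hpos (one_le_mul_of_one_le_of_one_le
    (one_le_cellProd fun d hd => h d (List.mem_append_left _ hd))
    (one_le_cellProd fun d hd => h d (List.mem_append_right _ (List.mem_cons_of_mem c hd))))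

theorem mem_table_iff {k : ℕ} {h : (Fin k → Bool) → ℝ≥0} {c : ℝ} :
    c ∈ table k h ↔ ∃ x, (h x : ℝ) = c := by
  induction k with
  | zero => simp [table, Unique.exists_iff, Subsingleton.elim default Fin.elim0, eq_comm]
  | succ k ih =>
    rw [table, List.mem_append, ih, ih, Fin.exists_fin_succ_pi, Bool.exists_bool]

namespace Application

variable {n : ℕ} (a : Application n)

theorem enc_nonneg {c : ℝ} (hc : c ∈ a.enc) : 0 ≤ c := by
  simp only [enc, List.mem_cons, List.mem_append, mem_table_iff, List.mem_ofFn] at hc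
  rcases hc with rfl | ⟨x, rfl⟩ | ⟨j, rfl⟩ <;> positivity

theorem val_mem_enc (x : Fin a.con.arity → Bool) : (a.con.val x : ℝ) ∈ a.enc :=
  List.mem_cons_of_mem _ (List.mem_append_left _ (mem_table_iff.2 ⟨x, rfl⟩))

/-- A number that bounds the values of the constraint in the sense of `Constraint.IsBoundedBy` and
that a machine can compute. -/
def bound : ℝ≥0 := (cellProd a.enc).toNNReal

theorem coe_bound : (a.bound : ℝ) = cellProd a.enc :=
  Real.coe_toNNReal _ (zero_le_one.trans (one_le_cellProd fun _ => a.enc_nonneg))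

theorem isBoundedBy_bound : a.con.IsBoundedBy a.bound := by
  refine ⟨?_, fun x => ?_, fun x hx => ?_⟩ <;> rw [← NNReal.coe_le_coe]
  · rw [coe_bound]
    exact one_le_cellProd fun _ => a.enc_nonneg
  · rw [coe_bound]
    exact (le_cellFactor (NNReal.coe_nonneg _)).trans
      (cellFactor_le_cellProd (fun _ => a.enc_nonneg) (a.val_mem_enc x))
  · have hpos : (0 : ℝ) < a.con.val x := NNReal.coe_pos.2 (pos_iff_ne_zero.2 hx)
    rw [NNReal.coe_mul, coe_bound]
    exact (one_le_mul_cellFactor hpos).trans (mul_le_mul_of_nonneg_left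
      (cellFactor_le_cellProd (fun _ => a.enc_nonneg) (a.val_mem_enc x)) hpos.le)

end Application

theorem coe_prod_map_bound {n : ℕ} (H : List (Application n)) :
    ((H.map Application.bound).prod : ℝ) = cellProd (H.flatMap Application.enc) := by
  induction H with
  | nil => rfl
  | cons a H ih =>
    rw [List.map_cons, List.prod_cons, NNReal.coe_mul, List.flatMap_cons, cellProd_append, ih,
      a.coe_bound]

theorem CSPInst.enc_nonneg {F : Set Constraint} (x : CSPInst F) {c : ℝ} (hc : c ∈ x.enc) :
    0 ≤ c := by
  simp only [CSPInst.enc, List.mem_append, List.mem_replicate, List.mem_cons,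
    List.mem_flatMap] at hc
  rcases hc with ⟨-, rfl⟩ | rfl | ⟨a, -, hc⟩
  · exact zero_le_one
  · exact le_rfl
  · exact a.enc_nonneg hc

theorem CSPInst.length_enc {F : Set Constraint} (x : CSPInst F) :
    x.enc.length = x.n + 1 + (x.H.flatMap Application.enc).length := by
  simp only [CSPInst.enc, List.length_append, List.length_replicate, List.length_cons]
  omega

theorem prod_map_bound_le {F : Set Constraint} (x : CSPInst F) :
    ((x.H.map Application.bound).prod : ℝ) ≤ cellProd x.enc := by
  have henc : x.enc = (List.replicate x.n 1 ++ [0]) ++ x.H.flatMap Application.enc := by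
    rw [CSPInst.enc, List.append_assoc, List.singleton_append]
  have hnonneg : ∀ c ∈ x.enc, 0 ≤ c := fun _ => x.enc_nonneg
  rw [henc] at hnonneg ⊢
  rw [coe_prod_map_bound, cellProd_append]
  exact le_mul_of_one_le_left
    (zero_le_one.trans (one_le_cellProd fun c hc => hnonneg c (List.mem_append_right _ hc)))
    (one_le_cellProd fun c hc => hnonneg c (List.mem_append_left _ hc))

namespace Gadget

variable {f : Constraint} {b : Bool} (G : Gadget f b)

/-- The constant factor in the weight, which is this factor times the square of a bound on the
values of the instance. -/
def scale : ℝ≥0 := G.D + 1 + 2 * G.D / G.κ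

section

variable {c P : ℝ≥0}

theorem D_le_mul_scale (hc : 1 ≤ c) : G.D ≤ c * c * G.scale := by
  refine le_mul_of_one_le_of_le (one_le_mul hc hc) ?_
  rw [scale, add_assoc]
  exact le_self_add

theorem two_mul_D_mul_sq_le (hP : P ≤ c) : 2 * G.D * P ^ 2 ≤ G.κ * (c * c * G.scale) :=
  calc 2 * G.D * P ^ 2 ≤ 2 * G.D * (c * c) := by rw [sq]; gcongr
    _ = G.κ * (c * c * (2 * G.D / G.κ)) := by
      rw [mul_left_comm G.κ, mul_div_cancel₀ _ G.κ_pos.ne', mul_comm]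
    _ ≤ G.κ * (c * c * G.scale) := by
      rw [scale]
      gcongr
      exact le_add_self

theorem lt_mul_scale (hc : 1 ≤ c) (hP : P ≤ c) : P < c * c * G.scale := by
  have hscale : 1 < G.scale :=
    calc 1 < 1 + 1 := lt_add_one 1
      _ ≤ G.D + 1 := by gcongr; exact G.one_le_D
      _ ≤ G.scale := le_self_add
  calc P ≤ c * c := hP.trans (le_mul_of_one_le_left zero_le hc)
    _ < c * c * G.scale := lt_mul_of_one_lt_right (by positivity) hscale

end

/-- The machine program that computes the weight, keeping the accuracy for later. -/
def weigh : Prog :=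
  .seq (block [.copy .input .accuracy, .pop .input, .push .weight 1])
    (.seq scan (.seq (drain .input) (block [.copy .weight .weight, .arith .mul .weight,
      .push .weight G.scale, .arith .mul .weight, .push .fresh 0])))

theorem runsIn_weigh (ε : ℝ) (l : List ℝ) :
    RunsIn G.weigh (Tape.store { input := ε :: l })
      (Tape.store {
        input := l
        weight := [cellProd l * cellProd l * G.scale]
        fresh := [0]
        accuracy := [ε] })
      (32 * l.length + 23) := by
  have hinit : RunsIn _ (Tape.store { input := ε :: l })
      (Tape.store { input := l, weight := [1], accuracy := [ε] }) _ :=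
    runsIn_block [.copy .input .accuracy, .pop .input, .push .weight 1] rfl
  have hscan := runsIn_scan { accuracy := [ε] } 1 l
  simp only [List.append_nil, one_mul] at hscan
  have hdrain := runsIn_drain (r := .input) nofun { weight := [cellProd l], accuracy := [ε] }
    l.reverse
  rw [List.reverse_reverse, List.length_reverse] at hdrain
  have hset : l ++ Tape.get { weight := [cellProd l], accuracy := [ε] } .input = l :=
    List.append_nil l
  rw [hset] at hdrain
  have hsquare : RunsIn _ (Tape.store { input := l, weight := [cellProd l], accuracy := [ε] })
      (Tape.store {
        input := l
        weight := [cellProd l * cellProd l * G.scale]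
        fresh := [0]
        accuracy := [ε] }) _ :=
    runsIn_block [.copy .weight .weight, .arith .mul .weight, .push .weight G.scale,
      .arith .mul .weight, .push .fresh 0] rfl
  refine (hinit.seq (hscan.seq (hdrain.seq hsquare))).mono ?_
  simp only [List.length_cons, List.length_nil]
  omega

/-- The machine program that writes the translated applications once the weight is known. -/
def writeApps : Prog := .seq count (.seq (block [.pop .input]) G.translate)

theorem runsIn_writeApps {F : Set Constraint} (x : CSPInst F) (W : ℝ≥0) (ε : ℝ) :
    RunsIn G.writeApps
      (Tape.store { input := x.enc, weight := [(W : ℝ)], fresh := [0], accuracy := [ε] })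
      (Tape.store {
        query := (G.trans W x.n x.H).flatMap RawApp.enc
        weight := [(W : ℝ)]
        fresh := [(G.vEnd x.n x.H : ℝ)]
        vars := List.replicate x.n 1
        accuracy := [ε] })
      ((2 * (CellExpr.codeList G.cells).length + 170) * x.enc.length + 10) := by
  have hcount := runsIn_count { weight := [(W : ℝ)], accuracy := [ε] } 0 x.n
    (x.H.flatMap Application.enc)
  simp only [List.append_nil, zero_add] at hcount
  have hpop : RunsIn _
      (Tape.store {
        input := 0 :: x.H.flatMap Application.enc
        weight := [(W : ℝ)]
        fresh := [(x.n : ℝ)]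
        vars := List.replicate x.n 1
        accuracy := [ε] }) _ _ :=
    runsIn_block [.pop .input] rfl
  have htranslate := G.runsIn_translate
    { vars := List.replicate x.n 1, accuracy := [ε] } W x.n x.H
  simp only [List.append_nil] at htranslate
  refine (hcount.seq (hpop.seq htranslate)).mono ?_
  simp only [List.length_cons, List.length_nil, x.length_enc]
  nlinarith

end Gadget

/-- The machine program that completes the oracle query by the number of variables, in unary, and
the accuracy. -/
def writeHeader : Prog :=
  .seq (block [.push .query 0]) (.seq ones (block [.copy .accuracy .query]))

theorem runsIn_writeHeader (T : Tape) (q : List ℝ) (v : ℕ) (ε : ℝ) :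
    RunsIn writeHeader
      (Tape.store { T with query := q, fresh := [(v : ℝ)], accuracy := [ε] })
      (Tape.store { T with
        query := ε :: (List.replicate v 1 ++ 0 :: q)
        fresh := [0]
        accuracy := [ε] })
      (8 * v + 9) := by
  have hpush := runsIn_block (T := { T with query := q, fresh := [(v : ℝ)], accuracy := [ε] })
    [.push .query 0] rfl
  have hones := runsIn_ones { T with query := 0 :: q, accuracy := [ε] } v
  have hcopy := runsIn_block (T := { T with
      query := List.replicate v 1 ++ 0 :: q
      fresh := [0]
      accuracy := [ε] }) [.copy .accuracy .query] rfl
  refine (hpush.seq (hones.seq hcopy)).mono ?_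
  simp only [List.length_cons, List.length_nil]
  omega

/-- The machine program that outputs the part of the answer of the oracle that assigns the
variables of the input. -/
def readAnswer : Prog := .seq take (drain .output)

theorem runsIn_readAnswer (T : Tape) (y l : List ℝ) :
    RunsIn readAnswer (Tape.store { T with answer := y, buffer := [], vars := l })
      (Tape.store { T with
        output := y.take l.length ++ T.output
        answer := y.drop l.length
        buffer := []
        vars := [] })
      (14 * l.length + 3) := by
  have htake := runsIn_take { T with buffer := [] } y l
  simp only [List.append_nil] at htake
  have hdrain := runsIn_drain (r := .output) nofun { T with answer := y.drop l.length, vars := [] }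
    (y.take l.length).reverse
  rw [List.reverse_reverse, List.length_reverse] at hdrain
  refine (htake.seq hdrain).mono ?_
  have hlen : (y.take l.length).length ≤ l.length := List.length_take_le _ _
  omega

theorem map_pos_take_map_bit (y : List Bool) (n : ℕ) :
    ((y.map bit).take n).map (fun r => decide (0 < r)) = y.take n := by
  rw [← List.map_take, List.map_map]
  refine (List.map_congr_left fun c _ => ?_).trans (List.map_id _)
  cases c <;> simp [bit]

theorem exists_runsIn_readAnswer (T : Tape) (y : List Bool) (n : ℕ) :
    ∃ s, RunsIn readAnswer
      (answered (Tape.store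
        { T with output := [], buffer := [], vars := List.replicate n 1 }) y) s (14 * n + 3) ∧
      (s 3).map (fun r => decide (0 < r)) = y.take n := by
  have hrun := runsIn_readAnswer { T with query := [], output := [] } (y.map bit)
    (List.replicate n 1)
  simp only [List.append_nil, List.length_replicate] at hrun
  rw [Tape.answered_store]
  exact ⟨_, hrun, map_pos_take_map_bit y n⟩

namespace Gadget

variable {f : Constraint} {b : Bool} (G : Gadget f b)

/-- The weight that the reduction uses for an instance. -/
def queryWeight {F : Set Constraint} (x : CSPInst F) : ℝ≥0 :=
  (cellProd x.enc).toNNReal * (cellProd x.enc).toNNReal * G.scale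

theorem exists_query (F : Set Constraint) (x : CSPInst ({forbid b} ∪ F ∪ U)) :
    ∃ w : CSPInst ({f} ∪ F ∪ U),
      w.enc = List.replicate (G.vEnd x.n x.H) 1 ++
        0 :: (G.trans (G.queryWeight x) x.n x.H).flatMap RawApp.enc ∧
      ∀ r : ℝ≥0, 1 ≤ r → r < 2 → ∀ y, (maxProdCSP ({f} ∪ F ∪ U)).IsApproxSol w r y →
        (maxProdCSP ({forbid b} ∪ F ∪ U)).IsApproxSol x r (y.take x.n) := by
  have hc : 1 ≤ (cellProd x.enc).toNNReal := by
    rw [Real.one_le_toNNReal]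
    exact one_le_cellProd fun _ => x.enc_nonneg
  have hP : (x.H.map Application.bound).prod ≤ (cellProd x.enc).toNNReal :=
    NNReal.le_toNNReal_of_coe_le (prod_map_bound_le x)
  exact G.exists_target_inst F x (fun a _ => a.isBoundedBy_bound) (G.D_le_mul_scale hc)
    (G.two_mul_D_mul_sq_le hP) (G.lt_mul_scale hc hP)

/-- The machine program that writes the oracle query. -/
def writeQuery : Prog := .seq G.weigh (.seq G.writeApps writeHeader)

theorem runsIn_writeQuery {F : Set Constraint} (x : CSPInst F) (ε : ℝ) :
    RunsIn G.writeQuery (Tape.store { input := ε :: x.enc })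
      (Tape.store {
        query := ε :: (List.replicate (G.vEnd x.n x.H) 1 ++
          0 :: (G.trans (G.queryWeight x) x.n x.H).flatMap RawApp.enc)
        weight := [(G.queryWeight x : ℝ)]
        fresh := [0]
        vars := List.replicate x.n 1
        accuracy := [ε] })
      ((2 * (CellExpr.codeList G.cells).length + 8 * G.aux + 210) * x.enc.length + 44) := by
  have hweight : (G.queryWeight x : ℝ) = cellProd x.enc * cellProd x.enc * G.scale := by
    rw [queryWeight, NNReal.coe_mul, NNReal.coe_mul,
      Real.coe_toNNReal _ (zero_le_one.trans (one_le_cellProd fun _ => x.enc_nonneg))]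
  have hweigh := G.runsIn_weigh ε x.enc
  rw [← hweight] at hweigh
  refine (hweigh.seq ((G.runsIn_writeApps x (G.queryWeight x) ε).seq (runsIn_writeHeader
    { weight := [(G.queryWeight x : ℝ)], vars := List.replicate x.n 1 } _ _ ε))).mono ?_
  have hv := G.vEnd_le x.n x.H
  have hlen := x.length_enc
  nlinarith

theorem aptReduces (G : Gadget f b) (F : Set Constraint) :
    APTReduces (maxProdCSPStar ({forbid b} ∪ F)) (maxProdCSPStar ({f} ∪ F)) := by
  refine aptReduces_of_singleQuery _ _ G.writeQuery readAnswer (MvPolynomial.X 1)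
    (MvPolynomial.C ((2 * (CellExpr.codeList G.cells).length + 8 * G.aux + 224 : ℕ) : ℝ) *
      MvPolynomial.X 0 + MvPolynomial.C 50) fun x ε hε₀ hε₁ => ?_
  obtain ⟨w, henc, happrox⟩ := G.exists_query F x
  have hquery := G.runsIn_writeQuery x ε
  choose out hanswer hout using fun y => exists_runsIn_readAnswer
    { query := ε :: w.enc, weight := [(G.queryWeight x : ℝ)], fresh := [0], accuracy := [ε] } y x.n
  rw [← henc, ← Tape.update_empty_zero] at hquery
  refine ⟨w, ε, _, _, _, out, hε₀, hε₁, ?_, rfl, hquery, hanswer, ?_, fun y hy => ?_⟩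
  · simp only [polyVal, MvPolynomial.eval_X, Matrix.cons_val_one, Matrix.cons_val_zero, le_refl]
  · have hlen := CSPInst.length_enc x
    simp only [polyVal, map_add, map_mul, MvPolynomial.eval_C, MvPolynomial.eval_X,
      Matrix.cons_val_zero]
    change _ ≤ _ * ((x.enc.length : ℕ) : ℝ) + 50
    norm_cast
    linarith
  · have hlt : (2 : ℝ≥0) ^ ε < 2 := by
      simpa only [NNReal.rpow_one] using NNReal.rpow_lt_rpow_of_exponent_lt one_lt_two hε₁
    have happrox_rpow := happrox (2 ^ ε) (NNReal.one_le_rpow one_le_two hε₀.le) hlt y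
    rw [NNReal.coe_rpow] at happrox_rpow
    rw [hout]
    exact happrox_rpow hy

end Gadget

end MaxProd

end

theorem mainTheorem5 (F : Set MaxProd.Constraint) (f : MaxProd.Constraint)
    (hNZ : f ∉ MaxProd.NZ) (hAffine : ¬ f.HasAffineSupport) (hImp : ¬ f.HasImpSupport) :
    ∃ g : MaxProd.Constraint, (g = MaxProd.OR ∨ g = MaxProd.NAND) ∧
      MaxProd.APTReduces (MaxProd.maxProdCSPStar ({g} ∪ F))
        (MaxProd.maxProdCSPStar ({f} ∪ F)) := by
  obtain ⟨b, ⟨G⟩⟩ := MaxProd.exists_gadget hAffine hImp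
  refine ⟨MaxProd.forbid b, ?_, G.aptReduces F⟩
  cases b
  · exact .inl MaxProd.forbid_false
  · exact .inr MaxProd.forbid_true
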